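/- Model. Fix an antenna height difference $L>0$, a transmission power $P>0$, a noise power $P_N\ge 0$, a constant $q>0$ (e.g. $q=3.5$), a number $N\ge1$ of pieces, breakpoints $L<d_1<\dots<d_{N-1}$, constants $A_n^{\mathrm L},A_n^{\mathrm{NL}},\alpha_n^{\mathrm L},\alpha_n^{\mathrm{NL}}>0$ and line-of-sight (LoS) probability functions $\mathrm{Pr}_n^{\mathrm L}$, $1\le n\le N$. The $n$-th piece is used for $d_{n-1}<w\le d_n$ (the first one for $L\le w\le d_1$, the last one for $w>d_{N-1}$); on it put $\zeta^{\mathrm L}(w)=\zeta_n^{\mathrm L}(w)=A_n^{\mathrm L}w^{-\alpha_n^{\mathrm L}}$, $\zeta^{\mathrm{NL}}(w)=A_n^{\mathrm{NL}}w^{-\alpha_n^{\mathrm{NL}}}$ and $\mathrm{Pr}^{\mathrm L}(w)=\mathrm{Pr}_n^{\mathrm L}(w)\in[0,1]$, where $\mathrm{Pr}_n^{\mathrm L}$ is non-increasing on the range of its piece, and $\mathrm{Pr}_1^{\mathrm L}(w)>0$ for some $w>L$ in the range of the first piece. Assume that $\zeta^{\mathrm L}(w)\le\zeta_1^{\mathrm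 L}(L)$ and $\zeta^{\mathrm{NL}}(w)\le\zeta_1^{\mathrm L}(L)$ for all $w\ge L$ (an LoS link of the minimal length $L$ is the strongest link). For $\lambda,\rho>0$ the base stations (BSs) form a homogeneous Poisson point process $\Phi$ on the plane with density $\lambda$, and the active BSs a subset $\tilde\Phi\subseteq\Phi$ that is a homogeneous Poisson point process with density $\tilde\lambda=\lambda\bigl[1-(1+\frac{\rho}{q\lambda})^{-q}\bigr]$. The typical user is at the origin. Given $\Phi$ and $\tilde\Phi$, the link to a BS at planar distance $r$, of length $w=\sqrt{r^2+L^2}$, has path loss $\zeta=\zeta^{\mathrm L}(w)$ with probability $\mathrm{Pr}^{\mathrm L}(w)$ and $\zeta=\zeta^{\mathrm{NL}}(w)$ otherwise, and an exponentially distributed channel gain of mean $1$, all independently. The user is served by the BS $b_o\in\Phi$ with the largest $\zeta$. With $h$ the channel gain of $b_o$ and $\zeta$ its path loss, $\mathrm{SINR}=P\zeta h/(I_{\mathrm{agg}}+P_N)$, where $I_{\mathrm{agg}}=\sum_{b_i\in\tilde\Phi\setminus\{b_o\}}P\beta_ig_i$ with $\beta_i$ and $g_i$ the path loss and the channel gain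 of $b_i$. Let $p^{\mathrm{cov}}(\lambda,\rho,\gamma)=\Pr[\mathrm{SINR}>\gamma]$. Lemma 2. Let $\gamma>0$, put $s=\gamma/(P\zeta_1^{\mathrm L}(L))$ and $$c(\gamma)=\exp\Bigl(-\frac{P_N\gamma}{P\zeta_1^{\mathrm L}(L)}\Bigr),$$ $$g(\gamma)=\exp\Bigl(-2\pi\int_0^\infty\frac{\mathrm{Pr}^{\mathrm L}(\sqrt{u^2+L^2})\,u}{1+\bigl(sP\zeta^{\mathrm L}(\sqrt{u^2+L^2})\bigr)^{-1}}\,du\Bigr)\exp\Bigl(-2\pi\int_0^\infty\frac{\bigl[1-\mathrm{Pr}^{\mathrm L}(\sqrt{u^2+L^2})\bigr]u}{1+\bigl(sP\zeta^{\mathrm{NL}}(\sqrt{u^2+L^2})\bigr)^{-1}}\,du\Bigr),$$ where both integrals are assumed to be finite. Then for every $\rho>0$ $$\lim_{\lambda\to+\infty}p^{\mathrm{cov}}(\lambda,\rho,\gamma)=c(\gamma)\,g(\gamma)^{\rho},$$ and for fixed $L$ and $\gamma$ this limit is strictly decreasing in $\rho\in(0,\infty)$. -/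

import Mathlib

open MeasureTheory ProbabilityTheory Filter Topology Set

noncomputable section

namespace SmallCell

/-- The plane in which base stations (BSs) are deployed; the typical user (UE) is at the origin. -/
abbrev Plane : Type := EuclideanSpace ℝ (Fin 2)

/-- The constants of the wireless model: the antenna height difference `L`, the BS transmission
power `P`, the noise power `PN`, the constant `q` in the density of active BSs, and the
multi-piece path loss model with `n + 1` pieces and `n` breakpoints. Pieces are indexed from `0`. -/
structure Params where
  /-- absolute BS-to-UE antenna height difference -/
  L : ℝ
  /-- BS transmission power -/
  P : ℝ
  /-- noise power -/
  PN : ℝ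
  /-- constant in the formula for the density of active BSs -/
  q : ℝ
  /-- number of breakpoints, one less than the number of pieces -/
  n : ℕ
  /-- breakpoints -/
  d : Fin n → ℝ
  /-- LoS reference path losses -/
  AL : Fin (n + 1) → ℝ
  /-- NLoS reference path losses -/
  ANL : Fin (n + 1) → ℝ
  /-- LoS path loss exponents -/
  αL : Fin (n + 1) → ℝ
  /-- NLoS path loss exponents -/
  αNL : Fin (n + 1) → ℝ
  /-- pieces of the LoS probability function -/
  prPiece : Fin (n + 1) → ℝ → ℝ

namespace Params

variable (p : Params)

/-- The piece used at 3D distance `w`: the number of breakpoints strictly below `w`, that is,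
the first piece for `w ≤ d₁`, the second one for `d₁ < w ≤ d₂`, ..., the last one beyond all
breakpoints. -/
def piece (w : ℝ) : Fin (p.n + 1) :=
  ⟨(Finset.univ.filter (fun k : Fin p.n => p.d k < w)).card,
    Nat.lt_succ_of_le ((Finset.card_le_univ _).trans_eq (Fintype.card_fin p.n))⟩

/-- LoS path loss at 3D distance `w`. -/
def zetaL (w : ℝ) : ℝ := p.AL (p.piece w) * w ^ (-p.αL (p.piece w))

/-- NLoS path loss at 3D distance `w`. -/
def zetaNL (w : ℝ) : ℝ := p.ANL (p.piece w) * w ^ (-p.αNL (p.piece w))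

/-- Probability that a link of 3D length `w` is LoS. -/
def prL (w : ℝ) : ℝ := p.prPiece (p.piece w) w

/-- The first-piece LoS path loss function. -/
def zetaOneL (w : ℝ) : ℝ := p.AL 0 * w ^ (-p.αL 0)

/-- 3D distance of a BS and a UE at 2D distance `r`. -/
def dist3 (r : ℝ) : ℝ := Real.sqrt (r ^ 2 + p.L ^ 2)

/-- Standing assumptions on the constants of the model. -/
structure Valid : Prop where
  L_pos : 0 < p.L
  P_pos : 0 < p.P
  PN_nonneg : 0 ≤ p.PN
  q_pos : 0 < p.q
  d_strictMono : StrictMono p.d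
  L_lt_d : ∀ k, p.L < p.d k
  AL_pos : ∀ k, 0 < p.AL k
  ANL_pos : ∀ k, 0 < p.ANL k
  αL_pos : ∀ k, 0 < p.αL k
  αNL_pos : ∀ k, 0 < p.αNL k
  /-- `prL` is a probability -/
  prL_mem : ∀ w, p.L ≤ w → p.prL w ∈ Icc (0 : ℝ) 1
  /-- on the range of each piece, the LoS probability is decreasing -/
  prL_anti : ∀ w₁ w₂, p.L ≤ w₁ → w₁ ≤ w₂ → p.piece w₁ = p.piece w₂ → p.prL w₂ ≤ p.prL w₁
  /-- LoS links occur at some distance in the range of the first piece -/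
  prL_pos : ∃ w, p.L < w ∧ p.piece w = 0 ∧ 0 < p.prL w
  /-- an LoS link of the minimal length `L` is the strongest possible link -/
  zetaL_le : ∀ w, p.L ≤ w → p.zetaL w ≤ p.zetaOneL p.L
  zetaNL_le : ∀ w, p.L ≤ w → p.zetaNL w ≤ p.zetaOneL p.L

/-- Density of the active BSs when BSs have density `lam` and UEs have density `rho`. -/
def activeDensity (lam rho : ℝ) : ℝ :=
  lam * (1 - 1 / (1 + rho / (p.q * lam)) ^ p.q)

/-- `s = γ / (P ζ₁ᴸ(L))`. -/
def s (γ : ℝ) : ℝ := γ / (p.P * p.zetaOneL p.L)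

/-- Integrand of the LoS interference integral. -/
def losIntegrand (γ u : ℝ) : ℝ :=
  p.prL (p.dist3 u) * u / (1 + (p.s γ * p.P * p.zetaL (p.dist3 u))⁻¹)

/-- Integrand of the NLoS interference integral. -/
def nlosIntegrand (γ u : ℝ) : ℝ :=
  (1 - p.prL (p.dist3 u)) * u / (1 + (p.s γ * p.P * p.zetaNL (p.dist3 u))⁻¹)

/-- The noise factor `c(γ)`. -/
def c (γ : ℝ) : ℝ := Real.exp (-(p.PN * γ / (p.P * p.zetaOneL p.L)))

/-- The interference factor `g(γ)`. -/
def g (γ : ℝ) : ℝ :=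
  Real.exp (-2 * Real.pi * ∫ u in Ioi (0 : ℝ), p.losIntegrand γ u) *
    Real.exp (-2 * Real.pi * ∫ u in Ioi (0 : ℝ), p.nlosIntegrand γ u)

end Params

/-- `Φ` is a homogeneous Poisson point process on the plane with density `lam`: the numbers of
points in pairwise disjoint bounded Borel sets are independent and Poisson distributed, with mean
`lam` times the area. -/
def IsHPPP {Ω : Type*} [MeasurableSpace Ω] (μ : Measure Ω) (lam : ℝ) (Φ : Ω → Set Plane) : Prop :=
  ∀ (m : ℕ) (B : Fin m → Set Plane),
    (∀ j, MeasurableSet (B j)) → (∀ j, Bornology.IsBounded (B j)) →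
    Pairwise (fun i j => Disjoint (B i) (B j)) →
    ∀ k : Fin m → ℕ,
      μ {ω | ∀ j, (Φ ω ∩ B j).encard = (k j : ℕ∞)} =
        ∏ j, ENNReal.ofReal (Real.exp (-(lam * volume.real (B j))) *
          (lam * volume.real (B j)) ^ k j / (k j).factorial)

/-- The random elements of a network, on a sample space `Ω`. -/
structure Network (Ω : Type*) where
  /-- enumeration of the BS locations -/
  bs : ℕ → Ω → Plane
  /-- whether a BS is active -/
  active : ℕ → Ω → Bool
  /-- uniform variables which decide whether the link of a BS to the typical UE is LoS -/
  unif : ℕ → Ω → ℝ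
  /-- fading gain of the link of a BS to the typical UE -/
  fading : ℕ → Ω → ℝ

namespace Network

variable {Ω : Type*} (N : Network Ω) (p : Params)

/-- The set of all BSs. -/
def bsSet (ω : Ω) : Set Plane := {x | ∃ i, N.bs i ω = x}

/-- The set of active BSs. -/
def activeSet (ω : Ω) : Set Plane := {x | ∃ i, N.active i ω = true ∧ N.bs i ω = x}

/-- 3D distance of a BS to the typical UE. -/
def dist (i : ℕ) (ω : Ω) : ℝ := p.dist3 ‖N.bs i ω‖

/-- Path loss of the link of a BS to the typical UE: given its 3D length `w`, the link is LoS
with probability `prL w`. -/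
def pathLoss (i : ℕ) (ω : Ω) : ℝ :=
  if N.unif i ω < p.prL (N.dist p i ω) then p.zetaL (N.dist p i ω) else p.zetaNL (N.dist p i ω)

/-- The BS serving the typical UE: the one with the largest average received power. A maximizer
exists and is unique almost surely; otherwise the convention does not matter. -/
def serving (ω : Ω) : ℕ := sInf {i | ∀ j, N.pathLoss p j ω ≤ N.pathLoss p i ω}

open Classical in
/-- Aggregate interference at the typical UE, from the active BSs other than the serving one. -/
def interference (ω : Ω) : ENNReal :=
  ∑' i, if N.active i ω = true ∧ i ≠ N.serving p ω then
    ENNReal.ofReal (p.P * N.pathLoss p i ω * N.fading i ω) else 0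

/-- SINR of the typical UE. -/
def sinr (ω : Ω) : ENNReal :=
  ENNReal.ofReal (p.P * N.pathLoss p (N.serving p ω) ω * N.fading (N.serving p ω) ω) /
    (N.interference p ω + ENNReal.ofReal p.PN)

/-- Coverage probability: the probability that the SINR of the typical UE exceeds `γ`. -/
def pcov [MeasurableSpace Ω] (μ : Measure Ω) (γ : ℝ) : ℝ :=
  μ.real {ω | ENNReal.ofReal γ < N.sinr p ω}

/-- The probabilistic model with BS density `lam` and UE density `rho`: BSs and active BSs are
Poisson processes; given these, the links to the typical UE are independently LoS or NLoS, and
undergo independent Rayleigh fading with mean power one. -/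
structure IsModel [MeasurableSpace Ω] (μ : Measure Ω) (lam rho : ℝ) : Prop where
  measurable_bs : ∀ i, Measurable (N.bs i)
  measurable_active : ∀ i, Measurable (N.active i)
  measurable_unif : ∀ i, Measurable (N.unif i)
  measurable_fading : ∀ i, Measurable (N.fading i)
  /-- the enumeration is without repetition -/
  bs_injective : ∀ ω, Function.Injective (fun i => N.bs i ω)
  bs_poisson : IsHPPP μ lam N.bsSet
  active_poisson : IsHPPP μ (p.activeDensity lam rho) N.activeSet
  unif_law : ∀ i, μ.map (N.unif i) = volume.restrict (Icc (0 : ℝ) 1)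
  fading_law : ∀ i, μ.map (N.fading i) = expMeasure 1
  unif_indep_fading : ∀ i, IndepFun (N.unif i) (N.fading i) μ
  marks_indep : iIndepFun (fun i ω => (N.unif i ω, N.fading i ω)) μ
  /-- the marks are independent of the locations and of the activity of the BSs -/
  marks_indep_bs : IndepFun (fun ω i => (N.bs i ω, N.active i ω))
    (fun ω i => (N.unif i ω, N.fading i ω)) μ

end Network

end SmallCell

end

/-! The gain of the serving link is a unit exponential independent of everything else, so
integrating it out turns the coverage probability into the mean of `exp (-θ)` with `θ = γ (I + PN) /
(P ζ)`, where `ζ` is the serving path loss and `I` the interference (`measure_lt_sinr`).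

As `lam → ∞`, the BSs become dense near the origin. For every `c > 1`, with probability tending to
one, some BS there has an LoS link of path loss at least `peak / c`, with `peak` the LoS path loss
at length `L`; the serving link is then at least as strong (`measure_weak_serving_le`). The active
density, however, tends to `rho` (`tendsto_activeDensity`), and the region that allows links of path
loss at least `peak / c` shrinks to a null set as `c → 1` (`tendsto_volume_strongRegion`). Hence the
serving BS is probably inactive, and removing it from the interference changes nothing.

Outside these unlikely events `θ` lies between its values for serving path losses `peak` and `peak /
c`, with all active BSs interfering (`le_threshold`, `threshold_le`). The Laplace functional of an
independently marked Poisson process (`lintegral_expNeg_marked`) evaluates both bounds through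
`totalAttenuation`, which grows at most by the factor `c` when its argument is scaled by `c`.
Letting `lam → ∞` and then `c → 1` gives the limit (`tendsto_measure_coverage`). Only the marginal
laws of the two point processes enter, through union bounds. Polar coordinates identify the limit
with `c γ * g γ ^ rho`, and the strict positivity of the LoS integral gives strict decrease. -/

noncomputable section

namespace SmallCell

open scoped ENNReal

/-! ### The exponential and the logarithm on `[0, ∞]` -/

/-- `exp (-x)` as a function on the extended nonnegative reals. -/
def expNeg (x : ℝ≥0∞) : ℝ≥0∞ := EReal.exp (-(x : EReal))

/-- `-log z` as a function on the extended nonnegative reals, truncated to `0` for `z ≥ 1`. -/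
def negLog (z : ℝ≥0∞) : ℝ≥0∞ := (-(ENNReal.log z)).toENNReal

lemma continuous_expNeg : Continuous expNeg :=
  ENNReal.continuous_exp.comp (continuous_neg.comp continuous_coe_ennreal_ereal)

lemma measurable_expNeg : Measurable expNeg := continuous_expNeg.measurable

@[fun_prop]
lemma _root_.Measurable.expNeg {α : Type*} [MeasurableSpace α] {f : α → ℝ≥0∞}
    (hf : Measurable f) : Measurable fun a => expNeg (f a) := measurable_expNeg.comp hf

@[fun_prop]
lemma _root_.Measurable.negLog {α : Type*} [MeasurableSpace α] {f : α → ℝ≥0∞}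
    (hf : Measurable f) : Measurable fun a => negLog (f a) := by
  unfold SmallCell.negLog
  exact measurable_ereal_toENNReal.comp (measurable_neg.comp hf.ennreal_log)

lemma expNeg_antitone : Antitone expNeg := fun _ _ h =>
  EReal.exp_monotone (EReal.neg_le_neg_iff.2 (EReal.coe_ennreal_le_coe_ennreal_iff.2 h))

@[simp] lemma expNeg_zero : expNeg 0 = 1 := by simp [expNeg]

@[simp] lemma expNeg_top : expNeg ∞ = 0 := by simp [expNeg]

lemma expNeg_le_one (x : ℝ≥0∞) : expNeg x ≤ 1 := by
  rw [← expNeg_zero]; exact expNeg_antitone zero_le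

lemma expNeg_ne_top (x : ℝ≥0∞) : expNeg x ≠ ∞ := ((expNeg_le_one x).trans_lt ENNReal.one_lt_top).ne

lemma expNeg_add (x y : ℝ≥0∞) : expNeg (x + y) = expNeg x * expNeg y := by
  rw [expNeg, expNeg, expNeg, ← EReal.exp_add, EReal.coe_ennreal_add, EReal.neg_add]
  · rfl
  · left; simp
  · right; simp

lemma expNeg_ofReal {t : ℝ} (ht : 0 ≤ t) :
    expNeg (ENNReal.ofReal t) = ENNReal.ofReal (Real.exp (-t)) := by
  rw [expNeg, EReal.coe_ennreal_ofReal, max_eq_left ht, ← EReal.coe_neg, EReal.exp_coe]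

lemma expNeg_sum {ι : Type*} (s : Finset ι) (f : ι → ℝ≥0∞) :
    expNeg (∑ i ∈ s, f i) = ∏ i ∈ s, expNeg (f i) := by
  classical
  induction s using Finset.induction_on with
  | empty => simp
  | insert a s ha ih => rw [Finset.sum_insert ha, Finset.prod_insert ha, expNeg_add, ih]

lemma expNeg_natCast_mul (n : ℕ) (x : ℝ≥0∞) : expNeg (n * x) = expNeg x ^ n := by
  have := expNeg_sum (Finset.range n) (fun _ => x)
  simpa using this

/-- For `z ≤ 1` the truncation in `negLog` is inactive, and `z = 0` corresponds to `∞`. Infinite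
products of numbers in `[0, 1]` can thus be handled as sums in `[0, ∞]`, without convergence
hypotheses. -/
lemma expNeg_negLog {z : ℝ≥0∞} (hz : z ≤ 1) : expNeg (negLog z) = z := by
  have h : (0 : EReal) ≤ -(ENNReal.log z) := by
    rw [EReal.le_neg, neg_zero]; exact ENNReal.log_le_zero_iff.2 hz
  rw [expNeg, negLog, EReal.coe_toENNReal h, neg_neg, ENNReal.exp_log]

lemma tendsto_prod_expNeg (f : ℕ → ℝ≥0∞) :
    Tendsto (fun n => ∏ i ∈ Finset.range n, expNeg (f i)) atTop (𝓝 (expNeg (∑' i, f i))) := by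
  simp_rw [← expNeg_sum]
  exact (continuous_expNeg.tendsto _).comp (ENNReal.tendsto_nat_tsum f)

lemma tendsto_lintegral_of_le_one {α : Type*} [MeasurableSpace α] {μ : Measure α}
    [IsFiniteMeasure μ] {F : ℕ → α → ℝ≥0∞} {f : α → ℝ≥0∞} (hF : ∀ n, Measurable (F n))
    (h1 : ∀ n a, F n a ≤ 1) (hlim : ∀ a, Tendsto (fun n => F n a) atTop (𝓝 (f a))) :
    Tendsto (fun n => ∫⁻ a, F n a ∂μ) atTop (𝓝 (∫⁻ a, f a ∂μ)) :=
  tendsto_lintegral_of_dominated_convergence (fun _ => 1) hF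
    (fun n => ae_of_all _ (h1 n)) (by simp) (ae_of_all _ hlim)

lemma lintegral_expNeg_le_one {α : Type*} [MeasurableSpace α] {μ : Measure α}
    [IsProbabilityMeasure μ] (f : α → ℝ≥0∞) : ∫⁻ a, expNeg (f a) ∂μ ≤ 1 :=
  (lintegral_mono fun a => expNeg_le_one (f a)).trans (by simp)

/-- The Laplace transform of a series of independent variables. -/
lemma lintegral_expNeg_tsum_of_iIndepFun {Ω E : Type*} [MeasurableSpace Ω] [MeasurableSpace E]
    {μ : Measure Ω} [IsProbabilityMeasure μ] {m : ℕ → Ω → E} (hm : ∀ i, Measurable (m i))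
    (hind : iIndepFun m μ) {G : ℕ → E → ℝ≥0∞} (hG : ∀ i, Measurable (G i)) :
    ∫⁻ ω, expNeg (∑' i, G i (m i ω)) ∂μ =
      expNeg (∑' i, negLog (∫⁻ x, expNeg (G i x) ∂(μ.map (m i)))) := by
  have hmeas : ∀ i, Measurable fun ω => expNeg (G i (m i ω)) :=
    fun i => ((hG i).comp (hm i)).expNeg
  have h1 : Tendsto (fun n => ∫⁻ ω, ∏ i ∈ Finset.range n, expNeg (G i (m i ω)) ∂μ) atTop
      (𝓝 (∫⁻ ω, expNeg (∑' i, G i (m i ω)) ∂μ)) :=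
    tendsto_lintegral_of_le_one (fun n => Finset.measurable_prod _ fun i _ => hmeas i)
      (fun n ω => Finset.prod_le_one' fun i _ => expNeg_le_one _)
      (fun ω => tendsto_prod_expNeg _)
  refine tendsto_nhds_unique h1 ?_
  have h2 := tendsto_prod_expNeg (fun i => negLog (∫⁻ x, expNeg (G i x) ∂(μ.map (m i))))
  refine h2.congr fun n => ?_
  have h3 : iIndepFun (fun i ω => expNeg (G i (m i ω))) μ :=
    hind.comp (fun i x => expNeg (G i x)) fun i => (hG i).expNeg
  have h4 := lintegral_prod_eq_prod_lintegral_of_indepFun (Finset.range n) _ h3 hmeas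
  rw [h4]
  refine Finset.prod_congr rfl fun i _ => ?_
  have := Measure.isProbabilityMeasure_map (μ := μ) (hm i).aemeasurable
  rw [expNeg_negLog (lintegral_expNeg_le_one _), lintegral_map (hG i).expNeg (hm i)]

/-! ### Laplace functionals of Poisson point processes -/

/-- The probability generating function of the Poisson distribution. -/
lemma tsum_poisson_mul_pow {t : ℝ} (ht : 0 ≤ t) {z : ℝ≥0∞} (hz : z ≤ 1) :
    ∑' k : ℕ, ENNReal.ofReal (Real.exp (-t) * t ^ k / k.factorial) * z ^ k =
      expNeg (ENNReal.ofReal t * (1 - z)) := by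
  lift z to NNReal using (hz.trans_lt ENNReal.one_lt_top).ne
  have hz' : (z : ℝ) ≤ 1 := by exact_mod_cast hz
  have h0 : ∀ k : ℕ, ENNReal.ofReal (Real.exp (-t) * t ^ k / k.factorial) * (z : ℝ≥0∞) ^ k =
      ENNReal.ofReal (Real.exp (-t) * ((t * z) ^ k / k.factorial)) := by
    intro k
    have hz1 : (z : ℝ≥0∞) = ENNReal.ofReal z := by simp
    rw [hz1, ← ENNReal.ofReal_pow z.coe_nonneg, ← ENNReal.ofReal_mul (by positivity)]
    congr 1
    ring
  simp_rw [h0]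
  have hs : HasSum (fun k : ℕ => Real.exp (-t) * ((t * z) ^ k / k.factorial))
      (Real.exp (-t) * Real.exp (t * z)) := by
    have := NormedSpace.expSeries_div_hasSum_exp (t * (z : ℝ))
    rw [← Real.exp_eq_exp_ℝ] at this
    exact this.mul_left _
  rw [← ENNReal.ofReal_tsum_of_nonneg (fun k => by positivity) hs.summable, hs.tsum_eq]
  have : ENNReal.ofReal t * (1 - (z : ℝ≥0∞)) = ENNReal.ofReal (t * (1 - z)) := by
    rw [ENNReal.ofReal_mul ht, ENNReal.ofReal_sub _ z.coe_nonneg]; simp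
  rw [this, expNeg_ofReal (mul_nonneg ht (by linarith)), ← Real.exp_add]
  congr 2
  ring

lemma tsum_pi_prod {n : ℕ} (f : Fin n → ℕ → ℝ≥0∞) :
    ∑' k : Fin n → ℕ, ∏ j, f j (k j) = ∏ j, ∑' i, f j i := by
  induction n with
  | zero => simp
  | succ n ih =>
    rw [← (Fin.consEquiv (fun _ => ℕ)).tsum_eq, ENNReal.tsum_prod', Fin.prod_univ_succ, ← ih]
    simp [Fin.prod_univ_succ, Fin.consEquiv, ENNReal.tsum_mul_left, ENNReal.tsum_mul_right]

/-- The sum of `f` over the points `x i ω` which are retained by `act`. -/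
def pointSum {Ω : Type*} (act : ℕ → Ω → Bool) (x : ℕ → Ω → Plane) (f : Plane → ℝ≥0∞) (ω : Ω) :
    ℝ≥0∞ := ∑' i, if act i ω = true then f (x i ω) else 0

/-- The set of the points `x i ω` which are retained by `act`. -/
def pointSet {Ω : Type*} (act : ℕ → Ω → Bool) (x : ℕ → Ω → Plane) (ω : Ω) : Set Plane :=
  {y | ∃ i, act i ω = true ∧ x i ω = y}

section

variable {Ω : Type*} {act : ℕ → Ω → Bool} {x : ℕ → Ω → Plane}

/-- Without repetitions in the enumeration, counting points is counting indices. -/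
lemma encard_pointSet_inter {ω : Ω} (hinj : Function.Injective fun i => x i ω) (B : Set Plane) :
    ((pointSet act x ω ∩ B).encard : ℝ≥0∞) = pointSum act x (B.indicator 1) ω := by
  classical
  have h1 : pointSet act x ω ∩ B = (fun i => x i ω) '' {i | act i ω = true ∧ x i ω ∈ B} := by
    ext y
    constructor
    · rintro ⟨⟨i, hi, rfl⟩, hB⟩
      exact ⟨i, ⟨hi, hB⟩, rfl⟩
    · rintro ⟨i, ⟨hi, hB⟩, rfl⟩
      exact ⟨⟨i, hi, rfl⟩, hB⟩
  rw [h1, hinj.encard_image, ← ENNReal.tsum_set_one, tsum_subtype _ (fun _ => (1 : ℝ≥0∞)), pointSum]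
  refine tsum_congr fun i => ?_
  by_cases ha : act i ω = true <;> by_cases hb : x i ω ∈ B <;> simp [ha, hb]

lemma measurable_pointSum [MeasurableSpace Ω] (hact : ∀ i, Measurable (act i))
    (hx : ∀ i, Measurable (x i)) {f : Plane → ℝ≥0∞} (hf : Measurable f) :
    Measurable (pointSum act x f) :=
  Measurable.tsum fun i => Measurable.ite (hact i (measurableSet_singleton true))
    (hf.comp (hx i)) measurable_const

lemma pointSum_sum {m : ℕ} (B : Fin m → Set Plane) (a : Fin m → ℝ≥0∞) (ω : Ω) :
    pointSum act x (fun y => ∑ j, (B j).indicator (fun _ => a j) y) ω =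
      ∑ j, pointSum act x ((B j).indicator 1) ω * a j := by
  simp_rw [pointSum, ← ENNReal.tsum_mul_right]
  rw [← Summable.tsum_finsetSum fun _ _ => ENNReal.summable]
  refine tsum_congr fun i => ?_
  by_cases ha : act i ω = true
  · simp only [ha, if_true]
    refine Finset.sum_congr rfl fun j _ => ?_
    by_cases hb : x i ω ∈ B j <;> simp [hb]
  · simp [ha]

lemma tendsto_pointSum {f : ℕ → Plane → ℝ≥0∞} {g : Plane → ℝ≥0∞} (hmono : Monotone f)
    (hlim : ∀ y, Tendsto (fun n => f n y) atTop (𝓝 (g y))) (ω : Ω) :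
    Tendsto (fun n => pointSum act x (f n) ω) atTop (𝓝 (pointSum act x g ω)) := by
  simp_rw [pointSum, ← lintegral_count]
  refine lintegral_tendsto_of_tendsto_of_monotone (fun n => (measurable_of_countable _).aemeasurable)
    (ae_of_all _ fun i n k hnk => ?_) (ae_of_all _ fun i => ?_)
  · by_cases ha : act i ω = true
    · simpa [ha] using hmono hnk _
    · simp [ha]
  · by_cases ha : act i ω = true
    · simpa [ha] using hlim _
    · simp [ha]

end

lemma sum_indicator_of_mem {m : ℕ} {B : Fin m → Set Plane}
    (hdisj : Pairwise fun i j => Disjoint (B i) (B j)) (a : Fin m → ℝ≥0∞) {y : Plane} {j : Fin m}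
    (hy : y ∈ B j) : ∑ i, (B i).indicator (fun _ => a i) y = a j := by
  rw [Finset.sum_eq_single j]
  · simp [hy]
  · intro i _ hij
    exact indicator_of_notMem (fun hi => (hdisj hij).le_bot ⟨hi, hy⟩) _
  · simp

/-- The event that the numbers of points in the sets `B j` are `k j`. -/
def countEvent {Ω : Type*} (act : ℕ → Ω → Bool) (x : ℕ → Ω → Plane) {m : ℕ} (B : Fin m → Set Plane)
    (k : Fin m → ℕ) : Set Ω :=
  {ω | ∀ j, (pointSet act x ω ∩ B j).encard = (k j : ℕ∞)}

lemma mem_countEvent_iff {Ω : Type*} {act : ℕ → Ω → Bool} {x : ℕ → Ω → Plane}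
    (hinj : ∀ ω, Function.Injective fun i => x i ω)
    {m : ℕ} {B : Fin m → Set Plane} {k : Fin m → ℕ} {ω : Ω} :
    ω ∈ countEvent act x B k ↔ ∀ j, pointSum act x ((B j).indicator 1) ω = (k j : ℝ≥0∞) := by
  simp only [countEvent, mem_ofPred_eq, ← encard_pointSet_inter (hinj ω)]
  refine forall_congr' fun j => ?_
  norm_cast

lemma pairwise_disjoint_countEvent {Ω : Type*} {act : ℕ → Ω → Bool} {x : ℕ → Ω → Plane} {m : ℕ}
    (B : Fin m → Set Plane) :
    Pairwise fun k l => Disjoint (countEvent act x B k) (countEvent act x B l) := fun k l hkl =>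
  Set.disjoint_left.2 fun ω hk hl => hkl (funext fun j => by
    have := (hk j).symm.trans (hl j)
    exact_mod_cast this)

lemma measurableSet_countEvent {Ω : Type*} [MeasurableSpace Ω] {act : ℕ → Ω → Bool}
    {x : ℕ → Ω → Plane} (hact : ∀ i, Measurable (act i))
    (hx : ∀ i, Measurable (x i)) (hinj : ∀ ω, Function.Injective fun i => x i ω)
    {m : ℕ} {B : Fin m → Set Plane} (hB : ∀ j, MeasurableSet (B j)) (k : Fin m → ℕ) :
    MeasurableSet (countEvent act x B k) := by
  have h : countEvent act x B k = ⋂ j, pointSum act x ((B j).indicator 1) ⁻¹' {(k j : ℝ≥0∞)} := by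
    ext ω
    simp [mem_countEvent_iff hinj]
  rw [h]
  exact MeasurableSet.iInter fun j => measurable_pointSum hact hx
    (measurable_one.indicator (hB j)) (measurableSet_singleton _)

section

variable {Ω : Type*} [MeasurableSpace Ω] {μ : Measure Ω} [IsProbabilityMeasure μ]
  {act : ℕ → Ω → Bool} {x : ℕ → Ω → Plane} {lam : ℝ}

/-- The Poisson weights sum to one (generating function at `z = 1`), which leaves no mass for
infinite counts. -/
lemma IsHPPP.ae_mem_iUnion_countEvent (hact : ∀ i, Measurable (act i))
    (hx : ∀ i, Measurable (x i)) (hinj : ∀ ω, Function.Injective fun i => x i ω) (hlam : 0 ≤ lam)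
    (hP : IsHPPP μ lam (pointSet act x)) {m : ℕ} {B : Fin m → Set Plane}
    (hB : ∀ j, MeasurableSet (B j)) (hbdd : ∀ j, Bornology.IsBounded (B j))
    (hdisj : Pairwise fun i j => Disjoint (B i) (B j)) :
    ∀ᵐ ω ∂μ, ω ∈ ⋃ k, countEvent act x B k := by
  have hSm := measurableSet_countEvent hact hx hinj hB
  have h1 : μ (⋃ k, countEvent act x B k) = 1 := by
    rw [measure_iUnion (pairwise_disjoint_countEvent B) hSm]
    simp_rw [countEvent, hP m B hB hbdd hdisj]
    rw [tsum_pi_prod fun j i => ENNReal.ofReal (Real.exp (-(lam * volume.real (B j))) *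
        (lam * volume.real (B j)) ^ i / i.factorial)]
    refine Finset.prod_eq_one fun j _ => ?_
    simpa using tsum_poisson_mul_pow (mul_nonneg hlam (measureReal_nonneg (s := B j))) (z := 1)
      le_rfl
  exact (mem_ae_iff_prob_eq_one (MeasurableSet.iUnion hSm)).2 h1

/-- The points of a homogeneous Poisson point process are almost surely locally finite. -/
lemma IsHPPP.ae_finite_inter (hact : ∀ i, Measurable (act i))
    (hx : ∀ i, Measurable (x i)) (hinj : ∀ ω, Function.Injective fun i => x i ω) (hlam : 0 ≤ lam)
    (hP : IsHPPP μ lam (pointSet act x)) {B : Set Plane} (hB : MeasurableSet B)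
    (hbdd : Bornology.IsBounded B) : ∀ᵐ ω ∂μ, (pointSet act x ω ∩ B).Finite := by
  filter_upwards [hP.ae_mem_iUnion_countEvent hact hx hinj hlam (m := 1) (B := fun _ => B)
    (fun _ => hB) (fun _ => hbdd) (fun i j hij => absurd (Subsingleton.elim i j) hij)] with ω hω
  obtain ⟨k, hk⟩ := mem_iUnion.1 hω
  exact Set.finite_of_encard_eq_coe (hk 0)

/-- Decomposing according to the vector of counts makes the integrand constant on each event. The
sum over vectors then factors into Poisson generating functions. -/
lemma IsHPPP.lintegral_expNeg_sum_count (hact : ∀ i, Measurable (act i))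
    (hx : ∀ i, Measurable (x i)) (hinj : ∀ ω, Function.Injective fun i => x i ω) (hlam : 0 ≤ lam)
    (hP : IsHPPP μ lam (pointSet act x)) {m : ℕ} {B : Fin m → Set Plane}
    (hB : ∀ j, MeasurableSet (B j)) (hbdd : ∀ j, Bornology.IsBounded (B j))
    (hdisj : Pairwise fun i j => Disjoint (B i) (B j)) (a : Fin m → ℝ≥0∞) :
    ∫⁻ ω, expNeg (∑ j, pointSum act x ((B j).indicator 1) ω * a j) ∂μ =
      expNeg (∑ j, ENNReal.ofReal lam * volume (B j) * (1 - expNeg (a j))) := by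
  let S : (Fin m → ℕ) → Set Ω := countEvent act x B
  have hSm := measurableSet_countEvent hact hx hinj hB
  have hSd := pairwise_disjoint_countEvent (act := act) (x := x) B
  have hpos : ∀ j, 0 ≤ lam * volume.real (B j) := fun j => mul_nonneg hlam measureReal_nonneg
  have hμS : ∀ k, μ (S k) = ∏ j, ENNReal.ofReal (Real.exp (-(lam * volume.real (B j))) *
          (lam * volume.real (B j)) ^ k j / (k j).factorial) := hP m B hB hbdd hdisj
  have hae := hP.ae_mem_iUnion_countEvent hact hx hinj hlam hB hbdd hdisj
  have hvol : ∀ j, ENNReal.ofReal lam * volume (B j) = ENNReal.ofReal (lam * volume.real (B j)) :=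
    fun j => by
      rw [ENNReal.ofReal_mul hlam, Measure.real, ENNReal.ofReal_toReal (hbdd j).measure_lt_top.ne]
  calc ∫⁻ ω, expNeg (∑ j, pointSum act x ((B j).indicator 1) ω * a j) ∂μ
      = ∫⁻ ω in ⋃ k, S k, expNeg (∑ j, pointSum act x ((B j).indicator 1) ω * a j) ∂μ := by
        rw [Measure.restrict_eq_self_of_ae_mem hae]
    _ = ∑' k, ∫⁻ ω in S k, expNeg (∑ j, pointSum act x ((B j).indicator 1) ω * a j) ∂μ :=
        lintegral_iUnion hSm hSd _
    _ = ∑' k : Fin m → ℕ, ∏ j, (ENNReal.ofReal (Real.exp (-(lam * volume.real (B j))) *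
          (lam * volume.real (B j)) ^ k j / (k j).factorial) * expNeg (a j) ^ k j) := by
        refine tsum_congr fun k => ?_
        rw [setLIntegral_congr_fun (g := fun _ => ∏ j, expNeg (a j) ^ k j) (hSm k),
          setLIntegral_const, hμS, mul_comm, Finset.prod_mul_distrib]
        intro ω hω
        rw [mem_countEvent_iff hinj] at hω
        simp only [expNeg_sum]
        refine Finset.prod_congr rfl fun j _ => ?_
        rw [hω j, expNeg_natCast_mul]
    _ = expNeg (∑ j, ENNReal.ofReal lam * volume (B j) * (1 - expNeg (a j))) := by
        rw [tsum_pi_prod fun j i => ENNReal.ofReal (Real.exp (-(lam * volume.real (B j))) *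
          (lam * volume.real (B j)) ^ i / i.factorial) * expNeg (a j) ^ i, expNeg_sum]
        refine Finset.prod_congr rfl fun j _ => ?_
        rw [hvol, tsum_poisson_mul_pow (hpos j) (expNeg_le_one _)]

/-- At most one summand is nonzero at each point, so `1 - expNeg` of a step function is again a step
function on the same sets. -/
lemma IsHPPP.lintegral_expNeg_pointSum_step (hact : ∀ i, Measurable (act i))
    (hx : ∀ i, Measurable (x i)) (hinj : ∀ ω, Function.Injective fun i => x i ω) (hlam : 0 ≤ lam)
    (hP : IsHPPP μ lam (pointSet act x)) {m : ℕ} {B : Fin m → Set Plane}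
    (hB : ∀ j, MeasurableSet (B j)) (hbdd : ∀ j, Bornology.IsBounded (B j))
    (hdisj : Pairwise fun i j => Disjoint (B i) (B j)) (a : Fin m → ℝ≥0∞) :
    ∫⁻ ω, expNeg (pointSum act x (fun y => ∑ j, (B j).indicator (fun _ => a j) y) ω) ∂μ =
      expNeg (ENNReal.ofReal lam *
        ∫⁻ y, (1 - expNeg (∑ j, (B j).indicator (fun _ => a j) y))) := by
  simp_rw [pointSum_sum]
  rw [hP.lintegral_expNeg_sum_count hact hx hinj hlam hB hbdd hdisj]
  have h1 : ∀ y, 1 - expNeg (∑ j, (B j).indicator (fun _ => a j) y) =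
      ∑ j, (B j).indicator (fun _ => 1 - expNeg (a j)) y := by
    intro y
    by_cases hy : ∃ j, y ∈ B j
    · obtain ⟨j, hj⟩ := hy
      rw [sum_indicator_of_mem hdisj _ hj, sum_indicator_of_mem hdisj _ hj]
    · push Not at hy
      simp [hy]
  simp_rw [h1]
  rw [lintegral_finsetSum _ fun j _ => measurable_const.indicator (hB j), Finset.mul_sum]
  congr 1
  refine Finset.sum_congr rfl fun j _ => ?_
  rw [lintegral_indicator (hB j), setLIntegral_const, mul_comm (1 - _), mul_assoc]

/-- The Laplace functional of a homogeneous Poisson point process. -/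
lemma IsHPPP.lintegral_expNeg_pointSum (hact : ∀ i, Measurable (act i))
    (hx : ∀ i, Measurable (x i)) (hinj : ∀ ω, Function.Injective fun i => x i ω) (hlam : 0 ≤ lam)
    (hP : IsHPPP μ lam (pointSet act x)) {f : Plane → ℝ≥0∞} (hf : Measurable f) :
    ∫⁻ ω, expNeg (pointSum act x f ω) ∂μ =
      expNeg (ENNReal.ofReal lam * ∫⁻ y, (1 - expNeg (f y))) := by
  -- The Poisson property concerns bounded sets only, so the simple approximations are also cut off
  -- to growing balls.
  let F : ℕ → Plane → ℝ≥0∞ := fun n => (Metric.ball 0 n).indicator (SimpleFunc.eapprox f n)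
  have hFm : ∀ n, Measurable (F n) := fun n =>
    (SimpleFunc.eapprox f n).measurable.indicator measurableSet_ball
  have hmono : Monotone F := fun n k hnk y => by
    refine (indicator_le_indicator_of_subset
      (Metric.ball_subset_ball (Nat.cast_le.2 hnk)) (fun _ => zero_le) y).trans ?_
    exact indicator_le_indicator (SimpleFunc.monotone_eapprox f hnk y)
  have hlim : ∀ y, Tendsto (fun n => F n y) atTop (𝓝 (f y)) := fun y => by
    refine (SimpleFunc.tendsto_eapprox hf y).congr' ?_
    obtain ⟨n, hn⟩ := exists_nat_gt (dist y 0)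
    filter_upwards [eventually_ge_atTop n] with k hk
    have : y ∈ Metric.ball (0 : Plane) k := Metric.mem_ball.2 (hn.trans_le (Nat.cast_le.2 hk))
    simp [F, indicator_of_mem this]
  have hstep : ∀ n, ∫⁻ ω, expNeg (pointSum act x (F n) ω) ∂μ =
      expNeg (ENNReal.ofReal lam * ∫⁻ y, (1 - expNeg (F n y))) := by
    intro n
    let g := SimpleFunc.eapprox f n
    let e := g.range.equivFin
    let B : Fin g.range.card → Set Plane := fun j =>
      g ⁻¹' {(e.symm j : ℝ≥0∞)} ∩ Metric.ball 0 n
    let a : Fin g.range.card → ℝ≥0∞ := fun j => (e.symm j : ℝ≥0∞)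
    have hdisj : Pairwise fun i j => Disjoint (B i) (B j) := fun i j hij =>
      Set.disjoint_left.2 fun y hi hj => hij (e.symm.injective (Subtype.ext
        ((show g y = _ from hi.1).symm.trans (show g y = _ from hj.1))))
    have hFB : F n = fun y => ∑ j, (B j).indicator (fun _ => a j) y := by
      funext y
      by_cases hy : y ∈ Metric.ball (0 : Plane) n
      · have hyB : y ∈ B (e ⟨g y, g.mem_range_self y⟩) := by simp [B, hy]
        rw [sum_indicator_of_mem hdisj a hyB]
        simp [F, indicator_of_mem hy, a, g]
      · have : ∀ j, y ∉ B j := fun j h => hy h.2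
        simp [F, hy, this]
    rw [hFB]
    exact hP.lintegral_expNeg_pointSum_step hact hx hinj hlam
      (fun j => (g.measurableSet_preimage _).inter measurableSet_ball)
      (fun j => Metric.isBounded_ball.subset inter_subset_right) hdisj a
  have hL : Tendsto (fun n => ∫⁻ ω, expNeg (pointSum act x (F n) ω) ∂μ) atTop
      (𝓝 (∫⁻ ω, expNeg (pointSum act x f ω) ∂μ)) :=
    tendsto_lintegral_of_le_one (fun n => (measurable_pointSum hact hx (hFm n)).expNeg)
      (fun n ω => expNeg_le_one _)
      (fun ω => (continuous_expNeg.tendsto _).comp (tendsto_pointSum hmono hlim ω))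
  have hR : Tendsto (fun n => ∫⁻ y, (1 - expNeg (F n y))) atTop
      (𝓝 (∫⁻ y, (1 - expNeg (f y)))) := by
    refine lintegral_tendsto_of_tendsto_of_monotone
      (fun n => (measurable_const.sub (hFm n).expNeg).aemeasurable)
      (ae_of_all _ fun y n k hnk => tsub_le_tsub_left (expNeg_antitone (hmono hnk y)) _)
      (ae_of_all _ fun y => ?_)
    exact ENNReal.Tendsto.sub tendsto_const_nhds
      ((continuous_expNeg.tendsto _).comp (hlim y)) (Or.inl ENNReal.one_ne_top)
  refine tendsto_nhds_unique hL ?_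
  simp_rw [hstep]
  exact (continuous_expNeg.tendsto _).comp
    (ENNReal.Tendsto.const_mul hR (Or.inr ENNReal.ofReal_ne_top))

/-- The Laplace functional of an independently marked homogeneous Poisson point process. -/
lemma IsHPPP.lintegral_expNeg_marked {E : Type*} [MeasurableSpace E] {mark : ℕ → Ω → E}
    {ν : Measure E} [IsProbabilityMeasure ν]
    (hact : ∀ i, Measurable (act i)) (hx : ∀ i, Measurable (x i))
    (hinj : ∀ ω, Function.Injective fun i => x i ω) (hlam : 0 ≤ lam)
    (hP : IsHPPP μ lam (pointSet act x)) (hmark : ∀ i, Measurable (mark i))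
    (hlaw : ∀ i, μ.map (mark i) = ν) (hmind : iIndepFun mark μ)
    (hind : IndepFun (fun ω i => (x i ω, act i ω)) (fun ω i => mark i ω) μ)
    {F : Plane → E → ℝ≥0∞} (hF : Measurable (Function.uncurry F)) :
    ∫⁻ ω, expNeg (∑' i, if act i ω = true then F (x i ω) (mark i ω) else 0) ∂μ =
      expNeg (ENNReal.ofReal lam * ∫⁻ y, (1 - ∫⁻ e, expNeg (F y e) ∂ν)) := by
  let X : Ω → ℕ → Plane × Bool := fun ω i => (x i ω, act i ω)
  let Y : Ω → ℕ → E := fun ω i => mark i ω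
  have hX : Measurable X := measurable_pi_lambda _ fun i => (hx i).prodMk (hact i)
  have hY : Measurable Y := measurable_pi_lambda _ hmark
  let K : (ℕ → Plane × Bool) × (ℕ → E) → ℝ≥0∞ := fun z =>
    expNeg (∑' i, if (z.1 i).2 = true then F (z.1 i).1 (z.2 i) else 0)
  have hK : Measurable K := by
    refine Measurable.expNeg (Measurable.tsum fun i => Measurable.ite ?_ ?_ measurable_const)
    · have h2 : Measurable fun z : (ℕ → Plane × Bool) × (ℕ → E) => (z.1 i).2 := by fun_prop
      exact h2 (measurableSet_singleton true)
    · have h3 : Measurable fun z : (ℕ → Plane × Bool) × (ℕ → E) => ((z.1 i).1, z.2 i) := by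
        fun_prop
      exact hF.comp h3
  -- By independence the marks can be averaged first, with locations and activities frozen.
  have h1 : ∫⁻ ω, K (X ω, Y ω) ∂μ = ∫⁻ ω, ∫⁻ ω', K (X ω, Y ω') ∂μ ∂μ := by
    rw [← lintegral_map hK (hX.prodMk hY),
      (indepFun_iff_map_prod_eq_prod_map_map hX.aemeasurable hY.aemeasurable).1 hind,
      lintegral_prod _ hK.aemeasurable, lintegral_map (by fun_prop) hX]
    refine lintegral_congr fun ω => ?_
    rw [lintegral_map (by fun_prop) hY]
  have hφ : Measurable fun y => negLog (∫⁻ e, expNeg (F y e) ∂ν) :=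
    (Measurable.lintegral_prod_right' hF.expNeg).negLog
  -- The mark average is a product over the points, which `negLog` turns into an unmarked point sum
  -- to which the Laplace functional applies.
  have h2 : ∀ ω, ∫⁻ ω', K (X ω, Y ω') ∂μ =
      expNeg (pointSum act x (fun y => negLog (∫⁻ e, expNeg (F y e) ∂ν)) ω) := by
    intro ω
    have hGm : ∀ i, Measurable fun e => if act i ω = true then F (x i ω) e else 0 := fun i => by
      split_ifs
      · exact hF.comp (measurable_const.prodMk measurable_id)
      · exact measurable_const
    have := lintegral_expNeg_tsum_of_iIndepFun hmark hmind hGm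
    refine this.trans ?_
    congr 1
    refine tsum_congr fun i => ?_
    rw [hlaw]
    split_ifs <;> simp [negLog]
  change ∫⁻ ω, K (X ω, Y ω) ∂μ = _
  rw [h1]
  simp_rw [h2]
  rw [hP.lintegral_expNeg_pointSum hact hx hinj hlam hφ]
  simp_rw [expNeg_negLog (lintegral_expNeg_le_one _)]

end

/-! ### Path loss as a function of location -/

namespace Params

variable (p : Params)

/-- A multi-piece power law with the breakpoints of the model. -/
def powerLaw (A α : Fin (p.n + 1) → ℝ) (w : ℝ) : ℝ := A (p.piece w) * w ^ (-α (p.piece w))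

lemma piece_mono : Monotone p.piece := fun _ _ h =>
  Fin.mk_le_mk.2 (Finset.card_le_card fun k hk => by
    simp only [Finset.mem_filter, Finset.mem_univ, true_and] at hk ⊢
    exact hk.trans_le h)

lemma measurable_piece : Measurable p.piece := by
  have h : Measurable fun w => (p.piece w : ℕ) :=
    Monotone.measurable fun _ _ h => p.piece_mono h
  refine measurable_to_countable' fun k => ?_
  convert h (measurableSet_singleton (k : ℕ)) using 1
  ext w
  simp [Fin.ext_iff]

lemma measurable_powerLaw (A α : Fin (p.n + 1) → ℝ) : Measurable (p.powerLaw A α) := by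
  have hA : Measurable fun w => A (p.piece w) := (measurable_of_countable A).comp p.measurable_piece
  have hα : Measurable fun w => -α (p.piece w) :=
    (measurable_of_countable fun k => -α k).comp p.measurable_piece
  exact hA.mul (measurable_id.pow hα)

lemma powerLaw_pos {A : Fin (p.n + 1) → ℝ} (hA : ∀ k, 0 < A k) (α : Fin (p.n + 1) → ℝ) {w : ℝ}
    (hw : 0 < w) : 0 < p.powerLaw A α w :=
  mul_pos (hA _) (Real.rpow_pos_of_pos hw _)

lemma eventually_powerLaw_lt (A : Fin (p.n + 1) → ℝ) {α : Fin (p.n + 1) → ℝ} (hα : ∀ k, 0 < α k)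
    {ε : ℝ} (hε : 0 < ε) : ∀ᶠ w in atTop, p.powerLaw A α w < ε := by
  have h : ∀ k, ∀ᶠ w : ℝ in atTop, A k * w ^ (-α k) < ε := fun k => by
    have := (tendsto_rpow_neg_atTop (hα k)).const_mul (A k)
    rw [mul_zero] at this
    exact this.eventually (gt_mem_nhds hε)
  filter_upwards [eventually_all.2 h] with w hw using hw _

lemma continuous_dist3 : Continuous p.dist3 := by
  unfold dist3
  fun_prop

lemma le_dist3 (r : ℝ) : p.L ≤ p.dist3 r :=
  Real.le_sqrt_of_sq_le (by nlinarith [sq_nonneg r])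

lemma dist3_pos (hp : p.Valid) (r : ℝ) : 0 < p.dist3 r := hp.L_pos.trans_le (p.le_dist3 r)

lemma dist3_zero (hp : p.Valid) : p.dist3 0 = p.L := by
  simp [dist3, Real.sqrt_sq hp.L_pos.le]

lemma le_dist3_self {r : ℝ} : r ≤ p.dist3 r :=
  Real.le_sqrt_of_sq_le (by nlinarith [sq_nonneg p.L])

lemma dist3_inj {r t : ℝ} (hr : 0 ≤ r) (ht : 0 ≤ t) (h : p.dist3 r = p.dist3 t) : r = t := by
  have h1 := (Real.sqrt_inj (by positivity) (by positivity)).1 h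
  exact (sq_eq_sq₀ hr ht).1 (by linarith)

/-- Monotonicity replaces a measurability hypothesis: on each piece the bounded decreasing function
extends to an antitone function on the whole line, and there are finitely many pieces. -/
lemma measurable_prL_dist3 (hp : p.Valid) : Measurable fun r => p.prL (p.dist3 r) := by
  have h : ∀ k, ∃ g : ℝ → ℝ, Antitone g ∧ EqOn p.prL g {w | p.L ≤ w ∧ p.piece w = k} := fun k =>
    AntitoneOn.exists_antitone_extension
      (fun a ha b hb hab => hp.prL_anti a b ha.1 hab (ha.2.trans hb.2.symm))
      ⟨0, by rintro _ ⟨w, hw, rfl⟩; exact (hp.prL_mem w hw.1).1⟩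
      ⟨1, by rintro _ ⟨w, hw, rfl⟩; exact (hp.prL_mem w hw.1).2⟩
  choose g hg hgeq using h
  have h1 : (fun r => p.prL (p.dist3 r)) = fun r => g (p.piece (p.dist3 r)) (p.dist3 r) :=
    funext fun r => hgeq _ ⟨p.le_dist3 r, rfl⟩
  have h2 : Measurable fun z : Fin (p.n + 1) × ℝ => g z.1 z.2 :=
    measurable_from_prod_countable_right fun k => (hg k).measurable
  rw [h1]
  have h3 := p.continuous_dist3.measurable
  exact h2.comp ((p.measurable_piece.comp h3).prodMk h3)

/-- The path loss of the strongest possible link. -/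
def peak : ℝ := p.zetaOneL p.L

lemma peak_pos (hp : p.Valid) : 0 < p.peak :=
  mul_pos (hp.AL_pos _) (Real.rpow_pos_of_pos hp.L_pos _)

/-- The path loss of a link from a BS at `x` whose LoS state is decided by `u`. -/
def linkLoss (x : Plane) (u : ℝ) : ℝ :=
  if u < p.prL (p.dist3 ‖x‖) then p.zetaL (p.dist3 ‖x‖) else p.zetaNL (p.dist3 ‖x‖)

lemma zetaL_pos (hp : p.Valid) (r : ℝ) : 0 < p.zetaL (p.dist3 r) :=
  p.powerLaw_pos hp.AL_pos p.αL (p.dist3_pos hp r)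

lemma zetaNL_pos (hp : p.Valid) (r : ℝ) : 0 < p.zetaNL (p.dist3 r) :=
  p.powerLaw_pos hp.ANL_pos p.αNL (p.dist3_pos hp r)

lemma measurable_zetaL_dist3 : Measurable fun r => p.zetaL (p.dist3 r) :=
  (p.measurable_powerLaw p.AL p.αL).comp p.continuous_dist3.measurable

lemma measurable_zetaNL_dist3 : Measurable fun r => p.zetaNL (p.dist3 r) :=
  (p.measurable_powerLaw p.ANL p.αNL).comp p.continuous_dist3.measurable

lemma linkLoss_pos (hp : p.Valid) (x : Plane) (u : ℝ) : 0 < p.linkLoss x u := by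
  unfold linkLoss
  split_ifs
  · exact p.zetaL_pos hp _
  · exact p.zetaNL_pos hp _

lemma linkLoss_le_peak (hp : p.Valid) (x : Plane) (u : ℝ) : p.linkLoss x u ≤ p.peak := by
  unfold linkLoss
  split_ifs
  · exact hp.zetaL_le _ (p.le_dist3 _)
  · exact hp.zetaNL_le _ (p.le_dist3 _)

lemma measurable_linkLoss (hp : p.Valid) :
    Measurable fun z : Plane × ℝ => p.linkLoss z.1 z.2 := by
  have hn : Measurable fun z : Plane × ℝ => ‖z.1‖ := measurable_fst.norm
  exact Measurable.ite (measurableSet_lt measurable_snd ((p.measurable_prL_dist3 hp).comp hn))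
    (p.measurable_zetaL_dist3.comp hn) (p.measurable_zetaNL_dist3.comp hn)

/-- The locations from which a link with path loss at least `peak / c` is possible. -/
def strongRegion (c : ℝ) : Set Plane :=
  {x | p.peak ≤ c * p.zetaL (p.dist3 ‖x‖) ∨ p.peak ≤ c * p.zetaNL (p.dist3 ‖x‖)}

/-- Forgets the LoS state, so that a strong link becomes a condition on the location alone. -/
lemma mem_strongRegion {c : ℝ} {x : Plane} {u : ℝ} (h : p.peak ≤ c * p.linkLoss x u) :
    x ∈ p.strongRegion c := by
  unfold linkLoss at h
  split_ifs at h
  · exact Or.inl h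
  · exact Or.inr h

lemma measurableSet_strongRegion (c : ℝ) : MeasurableSet (p.strongRegion c) := by
  have hn : Measurable fun x : Plane => ‖x‖ := measurable_norm
  exact (measurableSet_le measurable_const ((p.measurable_zetaL_dist3.comp hn).const_mul c)).union
    (measurableSet_le measurable_const ((p.measurable_zetaNL_dist3.comp hn).const_mul c))

lemma isBounded_strongRegion (hp : p.Valid) {c : ℝ} (hc : 0 < c) :
    Bornology.IsBounded (p.strongRegion c) := by
  have hε : 0 < p.peak / c := div_pos (p.peak_pos hp) hc
  obtain ⟨R, hR⟩ := ((p.eventually_powerLaw_lt p.AL hp.αL_pos hε).and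
    (p.eventually_powerLaw_lt p.ANL hp.αNL_pos hε)).exists_forall_of_atTop
  refine (Metric.isBounded_ball (x := (0 : Plane)) (r := R)).subset fun x hx => ?_
  rw [mem_ball_zero_iff]
  by_contra! h
  obtain ⟨h1, h2⟩ := hR _ (h.trans p.le_dist3_self)
  rw [lt_div_iff₀' hc] at h1 h2
  exact hx.elim (fun h3 => absurd h3 (not_le.2 h1)) (fun h3 => absurd h3 (not_le.2 h2))

/-- Each power law is injective in the distance, so the level set lies in a finite union of circles.
-/
lemma volume_powerLaw_eq (hp : p.Valid) {A α : Fin (p.n + 1) → ℝ} (hA : ∀ k, 0 < A k)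
    (hα : ∀ k, 0 < α k) (M : ℝ) :
    volume {x : Plane | p.powerLaw A α (p.dist3 ‖x‖) = M} = 0 := by
  have hsub : {x : Plane | p.powerLaw A α (p.dist3 ‖x‖) = M} ⊆
      ⋃ k, {x : Plane | A k * p.dist3 ‖x‖ ^ (-α k) = M} := fun x hx => mem_iUnion.2 ⟨_, hx⟩
  refine measure_mono_null hsub (measure_iUnion_null fun k => ?_)
  by_cases hne : ∃ y : Plane, A k * p.dist3 ‖y‖ ^ (-α k) = M
  · obtain ⟨y, hy⟩ := hne
    refine measure_mono_null (t := Metric.sphere 0 ‖y‖) (fun x hx => ?_)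
      (Measure.addHaar_sphere _ _ _)
    have h1 : p.dist3 ‖x‖ ^ (-α k) = p.dist3 ‖y‖ ^ (-α k) :=
      mul_left_cancel₀ (hA k).ne' (Eq.trans hx hy.symm)
    rw [Real.rpow_left_inj (p.dist3_pos hp _).le (p.dist3_pos hp _).le
      (neg_ne_zero.2 (hα k).ne')] at h1
    simpa using p.dist3_inj (norm_nonneg _) (norm_nonneg _) h1
  · push Not at hne
    convert measure_empty (μ := (volume : Measure Plane))
    ext x
    simpa using hne x

/-- The regions decrease, and a point in all of them has LoS or NLoS path loss exactly `peak`. Such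
points form a null set, and continuity from above applies since the regions are bounded. -/
lemma tendsto_volume_strongRegion (hp : p.Valid) :
    Tendsto (fun n : ℕ => volume (p.strongRegion (1 + 1 / ((n : ℝ) + 1)))) atTop (𝓝 0) := by
  have hanti : Antitone fun n : ℕ => p.strongRegion (1 + 1 / ((n : ℝ) + 1)) := by
    intro m n hmn x hx
    have h1 : 1 / ((n : ℝ) + 1) ≤ 1 / ((m : ℝ) + 1) := Nat.one_div_le_one_div hmn
    rcases hx with hx | hx
    · left; nlinarith [p.zetaL_pos hp ‖x‖]
    · right; nlinarith [p.zetaNL_pos hp ‖x‖]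
  have hnull : volume (⋂ n : ℕ, p.strongRegion (1 + 1 / ((n : ℝ) + 1))) = 0 := by
    refine measure_mono_null (t := {x : Plane | p.powerLaw p.AL p.αL (p.dist3 ‖x‖) = p.peak} ∪
      {x : Plane | p.powerLaw p.ANL p.αNL (p.dist3 ‖x‖) = p.peak}) (fun x hx => ?_)
      (measure_union_null (p.volume_powerLaw_eq hp hp.AL_pos hp.αL_pos _)
        (p.volume_powerLaw_eq hp hp.ANL_pos hp.αNL_pos _))
    rw [mem_iInter] at hx
    have hlim : ∀ z : ℝ, Tendsto (fun n : ℕ => (1 + 1 / ((n : ℝ) + 1)) * z) atTop (𝓝 z) :=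
      fun z => by
        simpa using (tendsto_one_div_add_atTop_nhds_zero_nat.const_add (1 : ℝ)).mul_const z
    by_contra hcon
    rw [mem_union, not_or] at hcon
    have h1 : p.zetaL (p.dist3 ‖x‖) < p.peak := (hp.zetaL_le _ (p.le_dist3 _)).lt_of_ne hcon.1
    have h2 : p.zetaNL (p.dist3 ‖x‖) < p.peak := (hp.zetaNL_le _ (p.le_dist3 _)).lt_of_ne hcon.2
    obtain ⟨n, hn1, hn2⟩ := (((hlim _).eventually (gt_mem_nhds h1)).and
      ((hlim _).eventually (gt_mem_nhds h2))).exists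
    exact (hx n).elim (fun h => absurd h (not_le.2 hn1)) (fun h => absurd h (not_le.2 hn2))
  rw [← hnull]
  exact tendsto_measure_iInter_atTop
    (fun n => (p.measurableSet_strongRegion _).nullMeasurableSet) hanti
    ⟨0, (p.isBounded_strongRegion hp (by positivity)).measure_lt_top.ne⟩

/-- Near the origin the link length is close to `L`, hence in the first piece and below a length
`w₀` of positive LoS probability. Monotonicity gives the uniform bound `a = prL w₀`, and continuity
of the first-piece power law gives the strength. -/
lemma exists_ball_strong (hp : p.Valid) {c : ℝ} (hc : 1 < c) :
    ∃ r : ℝ, 0 < r ∧ ∃ a : ℝ, 0 < a ∧ a ≤ 1 ∧ ∀ x ∈ Metric.ball (0 : Plane) r,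
      a ≤ p.prL (p.dist3 ‖x‖) ∧ p.peak ≤ c * p.zetaL (p.dist3 ‖x‖) := by
  obtain ⟨w₀, hLw, hpiece, hpos⟩ := hp.prL_pos
  have hd : Tendsto (fun x : Plane => p.dist3 ‖x‖) (𝓝 0) (𝓝 p.L) := by
    have := (p.continuous_dist3.comp continuous_norm).tendsto (0 : Plane)
    simpa [Function.comp_def, p.dist3_zero hp] using this
  have hz : Tendsto (fun x : Plane => c * p.zetaOneL (p.dist3 ‖x‖)) (𝓝 0) (𝓝 (c * p.peak)) :=
    (((continuousAt_id.rpow_const (Or.inl hp.L_pos.ne')).tendsto.comp hd).const_mul _).const_mul c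
  have h1 : p.peak < c * p.peak := by nlinarith [p.peak_pos hp]
  obtain ⟨r, hr, hball⟩ := Metric.eventually_nhds_iff_ball.1
    ((hd.eventually (gt_mem_nhds hLw)).and (hz.eventually (lt_mem_nhds h1)))
  refine ⟨r, hr, p.prL w₀, hpos, (hp.prL_mem _ hLw.le).2, fun x hx => ?_⟩
  obtain ⟨h2, h3⟩ := hball x hx
  have h4 : p.piece (p.dist3 ‖x‖) = 0 := by
    have := p.piece_mono h2.le
    rw [hpiece] at this
    exact le_antisymm this (Fin.zero_le _)
  refine ⟨hp.prL_anti _ _ (p.le_dist3 _) h2.le (h4.trans hpiece.symm), ?_⟩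
  have : p.zetaL (p.dist3 ‖x‖) = p.zetaOneL (p.dist3 ‖x‖) := by
    rw [zetaL, h4, zetaOneL]
  rw [this]
  exact h3.le

end Params

/-! ### Independence, and integrating out an exponential variable -/

section Independence

/-- In an independent sequence, each variable is independent of all the others. -/
lemma _root_.ProbabilityTheory.iIndepFun.indepFun_ite {Ω E : Type*} [MeasurableSpace Ω]
    [MeasurableSpace E] {μ : Measure Ω}
    {m : ℕ → Ω → E} (hm : ∀ i, Measurable (m i)) (h : iIndepFun m μ) (k : ℕ) (e : E) :
    IndepFun (m k) (fun ω i => if i = k then e else m i ω) μ := by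
  rw [IndepFun_iff_Indep]
  have hd := indep_iSup_of_disjoint (fun i => (hm i).comap_le) h
    (disjoint_compl_right (a := ({k} : Set ℕ)))
  refine indep_of_indep_of_le_left (indep_of_indep_of_le_right hd ?_) ?_
  · rw [← measurable_iff_comap_le]
    refine @measurable_pi_lambda _ _ _ (_) _ _ fun i => ?_
    by_cases hik : i = k
    · simp only [hik, if_true]
      exact measurable_const
    · simp only [hik, if_false]
      exact measurable_iff_comap_le.2 (le_iSup₂_of_le i (by simpa using hik) le_rfl)
  · exact le_iSup₂_of_le k rfl le_rfl

variable {Ω : Type*} [MeasurableSpace Ω] {μ : Measure Ω} [IsProbabilityMeasure μ]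

/-- The hypotheses make the joint law of the triple a product measure, which can be reassociated. -/
lemma _root_.ProbabilityTheory.IndepFun.prodMk_right_of_prodMk_left {α β δ : Type*}
    [MeasurableSpace α] [MeasurableSpace β] [MeasurableSpace δ] {A : Ω → α} {B : Ω → β} {C : Ω → δ}
    (hA : Measurable A) (hB : Measurable B) (hC : Measurable C) (h1 : IndepFun A B μ)
    (h2 : IndepFun (fun ω => (A ω, B ω)) C μ) : IndepFun A (fun ω => (B ω, C ω)) μ := by
  have hBC : IndepFun B C μ := h2.comp measurable_snd measurable_id
  have := Measure.isProbabilityMeasure_map (μ := μ) hA.aemeasurable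
  have := Measure.isProbabilityMeasure_map (μ := μ) hB.aemeasurable
  have := Measure.isProbabilityMeasure_map (μ := μ) hC.aemeasurable
  rw [indepFun_iff_map_prod_eq_prod_map_map hA.aemeasurable (hB.prodMk hC).aemeasurable,
    (indepFun_iff_map_prod_eq_prod_map_map hB.aemeasurable hC.aemeasurable).1 hBC,
    ← (measurePreserving_prodAssoc (μ.map A) (μ.map B) (μ.map C)).map_eq,
    ← (indepFun_iff_map_prod_eq_prod_map_map hA.aemeasurable hB.aemeasurable).1 h1,
    ← (indepFun_iff_map_prod_eq_prod_map_map (hA.prodMk hB).aemeasurable hC.aemeasurable).1 h2,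
    Measure.map_map MeasurableEquiv.prodAssoc.measurable ((hA.prodMk hB).prodMk hC)]
  rfl

lemma expMeasure_lt_ofReal (y : ℝ≥0∞) :
    expMeasure 1 {h : ℝ | y < ENNReal.ofReal h} = expNeg y := by
  have := isProbabilityMeasure_expMeasure one_pos
  induction y with
  | top => simp
  | coe y =>
    have h1 : {h : ℝ | (y : ℝ≥0∞) < ENNReal.ofReal h} = (Iic (y : ℝ))ᶜ := by
      ext h
      rw [← ENNReal.ofReal_coe_nnreal, mem_ofPred_eq, mem_compl_iff, mem_Iic, not_le,
        ENNReal.ofReal_lt_ofReal_iff_of_nonneg y.coe_nonneg]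
    have h2 := cdf_expMeasure_eq one_pos (y : ℝ)
    rw [cdf_eq_real, if_pos y.coe_nonneg, one_mul] at h2
    rw [h1, ← ENNReal.ofReal_coe_nnreal, expNeg_ofReal y.coe_nonneg, ← ofReal_measureReal,
      probReal_compl_eq_one_sub measurableSet_Iic, h2, sub_sub_cancel]

/-- Fubini for the product law of `Z` and `h`: the inner integral is the exponential tail at `Y`,
which vanishes where `Y = ∞`. -/
lemma measure_and_lt_ofReal {E : Type*} [MeasurableSpace E] {Z : Ω → E} {h : Ω → ℝ}
    (hZ : Measurable Z) (hh : Measurable h) (hind : IndepFun h Z μ)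
    (hlaw : μ.map h = expMeasure 1) {A : Set E} (hA : MeasurableSet A) {Y : E → ℝ≥0∞}
    (hY : Measurable Y) :
    μ {ω | Z ω ∈ A ∧ Y (Z ω) < ENNReal.ofReal (h ω)} = ∫⁻ ω in Z ⁻¹' A, expNeg (Y (Z ω)) ∂μ := by
  have := isProbabilityMeasure_expMeasure one_pos
  have := Measure.isProbabilityMeasure_map (μ := μ) hZ.aemeasurable
  let D : Set (E × ℝ) := {z | z.1 ∈ A ∧ Y z.1 < ENNReal.ofReal z.2}
  have hD : MeasurableSet D := (measurable_fst hA).inter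
    (measurableSet_lt (hY.comp measurable_fst) measurable_snd.ennreal_ofReal)
  have h1 : {ω | Z ω ∈ A ∧ Y (Z ω) < ENNReal.ofReal (h ω)} = (fun ω => (Z ω, h ω)) ⁻¹' D := rfl
  rw [h1, ← Measure.map_apply (hZ.prodMk hh) hD,
    (indepFun_iff_map_prod_eq_prod_map_map hZ.aemeasurable hh.aemeasurable).1 hind.symm, hlaw,
    Measure.prod_apply hD, ← lintegral_indicator (hZ hA)]
  refine Eq.trans ?_ (lintegral_map (f := A.indicator fun z => expNeg (Y z))
    (hY.expNeg.indicator hA) hZ)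
  refine lintegral_congr fun z => ?_
  by_cases hz : z ∈ A
  · rw [indicator_of_mem hz, ← expMeasure_lt_ofReal]
    congr 1
    ext t
    simp [D, hz]
  · rw [indicator_of_notMem hz]
    convert measure_empty (μ := expMeasure 1)
    ext t
    simp [D, hz]

end Independence

/-! ### Coverage probability as a mean of `expNeg` of the threshold -/

namespace Network

variable {Ω : Type*} (N : Network Ω) (p : Params)

open Classical in
/-- Interference from the active BSs other than the `k`-th one. -/
def interferenceExcept (k : ℕ) (ω : Ω) : ℝ≥0∞ :=
  ∑' i, if N.active i ω = true ∧ i ≠ k then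
    ENNReal.ofReal (p.P * N.pathLoss p i ω * N.fading i ω) else 0

/-- The smallest channel gain for which a user served by the `k`-th BS is covered. -/
def threshold (γ : ℝ) (k : ℕ) (ω : Ω) : ℝ≥0∞ :=
  ENNReal.ofReal γ * (N.interferenceExcept p k ω + ENNReal.ofReal p.PN) /
    ENNReal.ofReal (p.P * N.pathLoss p k ω)

variable {N p}

lemma pathLoss_eq (i : ℕ) (ω : Ω) : N.pathLoss p i ω = p.linkLoss (N.bs i ω) (N.unif i ω) := rfl

/-- The rearrangement survives infinite interference and a zero denominator because `γ` and the
serving path loss are positive and finite. -/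
lemma lt_sinr_iff (hp : p.Valid) {γ : ℝ} (hγ : 0 < γ) (ω : Ω) :
    ENNReal.ofReal γ < N.sinr p ω ↔
      N.threshold p γ (N.serving p ω) ω < ENNReal.ofReal (N.fading (N.serving p ω) ω) := by
  have hpos : 0 < p.P * N.pathLoss p (N.serving p ω) ω :=
    mul_pos hp.P_pos (p.linkLoss_pos hp _ _)
  have h1 : N.interference p ω = N.interferenceExcept p (N.serving p ω) ω := rfl
  rw [sinr, ENNReal.lt_div_iff_mul_lt (Or.inr ENNReal.ofReal_ne_top)
    (Or.inr (ENNReal.ofReal_pos.2 hγ).ne'), threshold, ENNReal.div_lt_iff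
    (Or.inl (ENNReal.ofReal_pos.2 hpos).ne') (Or.inl ENNReal.ofReal_ne_top), h1,
    ENNReal.ofReal_mul hpos.le, mul_comm (ENNReal.ofReal (N.fading _ _))]

section Measurability

variable [MeasurableSpace Ω]

lemma measurable_pathLoss (hp : p.Valid) (hb : ∀ i, Measurable (N.bs i))
    (hu : ∀ i, Measurable (N.unif i)) (i : ℕ) : Measurable (N.pathLoss p i) :=
  (p.measurable_linkLoss hp).comp ((hb i).prodMk (hu i))

lemma measurable_serving (hp : p.Valid) (hb : ∀ i, Measurable (N.bs i))
    (hu : ∀ i, Measurable (N.unif i)) : Measurable (N.serving p) := by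
  classical
  have hpl := measurable_pathLoss hp hb hu
  let S : ℕ → Set Ω := fun i => {ω | ∀ j, N.pathLoss p j ω ≤ N.pathLoss p i ω}
  have hS : ∀ i, MeasurableSet (S i) := fun i => by
    have : S i = ⋂ j, {ω | N.pathLoss p j ω ≤ N.pathLoss p i ω} := by
      ext ω
      simp [S]
    rw [this]
    exact MeasurableSet.iInter fun j => measurableSet_le (hpl j) (hpl i)
  refine measurable_to_countable' fun k => ?_
  -- Since `sInf ∅ = 0`, the index `0` also collects the outcomes without a maximizer.
  have h1 : N.serving p ⁻¹' {k} = (S k ∩ ⋂ j ∈ Iio k, (S j)ᶜ) ∪ {ω | k = 0 ∧ ∀ j, ω ∉ S j} := by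
    ext ω
    have hdef : N.serving p ω = sInf {i | ω ∈ S i} := rfl
    rw [mem_preimage, mem_singleton_iff, hdef]
    by_cases hne : {i | ω ∈ S i}.Nonempty
    · obtain ⟨i, hi⟩ := hne
      have hmem : ω ∈ S (sInf {i | ω ∈ S i}) := Nat.sInf_mem ⟨i, hi⟩
      constructor
      · rintro rfl
        refine Or.inl ⟨hmem, mem_iInter₂.2 fun j hj hjS => ?_⟩
        exact absurd (Nat.sInf_le (s := {i | ω ∈ S i}) hjS) (not_le.2 hj)
      · rintro (⟨hk, hlt⟩ | ⟨-, hall⟩)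
        · refine le_antisymm (Nat.sInf_le hk) (not_lt.1 fun hlt' => ?_)
          exact mem_iInter₂.1 hlt _ hlt' hmem
        · exact absurd hi (hall i)
    · rw [Set.not_nonempty_iff_eq_empty] at hne
      have hall : ∀ j, ω ∉ S j := fun j hj => by
        have : j ∈ {i | ω ∈ S i} := hj
        rw [hne] at this
        exact this
      rw [hne, Nat.sInf_empty]
      constructor
      · rintro rfl
        exact Or.inr ⟨rfl, hall⟩
      · rintro (⟨hk, -⟩ | ⟨hk, -⟩)
        · exact absurd hk (hall k)
        · exact hk.symm
  rw [h1]
  refine MeasurableSet.union ((hS k).inter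
    (MeasurableSet.biInter (to_countable _) fun j _ => (hS j).compl)) ?_
  have h2 : {ω | k = 0 ∧ ∀ j, ω ∉ S j} = {_ω | k = 0} ∩ ⋂ j, (S j)ᶜ := by
    ext ω
    simp
  rw [h2]
  exact (MeasurableSet.const _).inter (MeasurableSet.iInter fun j => (hS j).compl)

lemma measurable_threshold (hp : p.Valid) (hb : ∀ i, Measurable (N.bs i))
    (ha : ∀ i, Measurable (N.active i)) (hu : ∀ i, Measurable (N.unif i))
    (hf : ∀ i, Measurable (N.fading i)) (γ : ℝ) (k : ℕ) : Measurable (N.threshold p γ k) := by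
  have hpl := measurable_pathLoss hp hb hu
  have hI : Measurable (N.interferenceExcept p k) := by
    refine Measurable.tsum fun i => Measurable.ite ?_
      (((hpl i).const_mul _).mul (hf i)).ennreal_ofReal measurable_const
    exact (ha i (measurableSet_singleton true)).inter (MeasurableSet.const _)
  exact ((hI.add_const _).const_mul _).div ((hpl k).const_mul _).ennreal_ofReal

end Measurability

/-- The network on the space of all values of locations, activities, and marks. -/
def canonical : Network ((ℕ → Plane × Bool) × (ℕ → ℝ) × (ℕ → ℝ)) where
  bs i z := (z.1 i).1
  active i z := (z.1 i).2
  unif i z := z.2.1 i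
  fading i z := z.2.2 i

/-- The values of all the random elements, with the `k`-th channel gain erased. -/
def valuesExcept (N : Network Ω) (k : ℕ) (ω : Ω) : (ℕ → Plane × Bool) × (ℕ → ℝ) × (ℕ → ℝ) :=
  (fun i => (N.bs i ω, N.active i ω), fun i => N.unif i ω,
    fun i => if i = k then 0 else N.fading i ω)

/-- The `k`-th threshold does not involve the `k`-th gain, so it factors through the remaining
values. This is what allows that gain to be integrated out. -/
lemma canonical_threshold (γ : ℝ) (k : ℕ) (ω : Ω) :
    canonical.threshold p γ k (N.valuesExcept k ω) = N.threshold p γ k ω := by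
  have : canonical.interferenceExcept p k (N.valuesExcept k ω) = N.interferenceExcept p k ω := by
    refine tsum_congr fun i => ?_
    by_cases hik : i = k
    · simp [hik]
    · simp only [canonical, valuesExcept, hik, if_false]
      rfl
  rw [threshold, this]
  rfl

namespace IsModel

variable [MeasurableSpace Ω] {μ : Measure Ω} [IsProbabilityMeasure μ] {lam rho : ℝ}

/-- The `k`-th gain is separated successively from its own uniform variable, from the marks of the
other BSs, and from the locations and activities. -/
lemma indepFun_fading_valuesExcept (h : N.IsModel p μ lam rho) (k : ℕ) :
    IndepFun (N.fading k) (N.valuesExcept k) μ := by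
  have hm : ∀ i, Measurable fun ω => (N.unif i ω, N.fading i ω) :=
    fun i => (h.measurable_unif i).prodMk (h.measurable_fading i)
  have hloc : Measurable fun ω i => (N.bs i ω, N.active i ω) :=
    measurable_pi_lambda _ fun i => (h.measurable_bs i).prodMk (h.measurable_active i)
  let m' : Ω → ℕ → ℝ × ℝ := fun ω i => if i = k then (0, 0) else (N.unif i ω, N.fading i ω)
  have hm' : Measurable m' := measurable_pi_lambda _ fun i => by
    by_cases hik : i = k
    · simp [m', hik]
    · simpa [m', hik] using hm i
  have h1 : IndepFun (fun ω => (N.fading k ω, N.unif k ω)) m' μ :=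
    (h.marks_indep.indepFun_ite hm k (0, 0)).comp measurable_swap measurable_id
  have h2 := (h.unif_indep_fading k).symm.prodMk_right_of_prodMk_left
    (h.measurable_fading k) (h.measurable_unif k) hm' h1
  have h3 : IndepFun (fun ω => (N.fading k ω, (N.unif k ω, m' ω)))
      (fun ω i => (N.bs i ω, N.active i ω)) μ := by
    have hg : Measurable fun z : ℕ → ℝ × ℝ =>
        ((z k).2, ((z k).1, fun i => if i = k then ((0 : ℝ), (0 : ℝ)) else z i)) := by
      refine (measurable_snd.comp (measurable_pi_apply k)).prodMk
        ((measurable_fst.comp (measurable_pi_apply k)).prodMk (measurable_pi_lambda _ fun i => ?_))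
      by_cases hik : i = k
      · simp [hik]
      · simpa [hik] using measurable_pi_apply i
    exact h.marks_indep_bs.symm.comp hg measurable_id
  have h4 := h2.prodMk_right_of_prodMk_left (h.measurable_fading k)
    ((h.measurable_unif k).prodMk hm') hloc h3
  have hg : Measurable fun z : (ℝ × (ℕ → ℝ × ℝ)) × (ℕ → Plane × Bool) =>
      (z.2, (fun i => if i = k then z.1.1 else (z.1.2 i).1), fun i => (z.1.2 i).2) := by
    refine measurable_snd.prodMk (Measurable.prodMk (measurable_pi_lambda _ fun i => ?_)
      (by fun_prop))
    by_cases hik : i = k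
    · simp only [hik, if_true]
      fun_prop
    · simp only [hik, if_false]
      fun_prop
  have h5 := h4.comp measurable_id hg
  have heq : N.valuesExcept k = fun ω => ((fun i => (N.bs i ω, N.active i ω)),
      (fun i => if i = k then N.unif k ω else (m' ω i).1), fun i => (m' ω i).2) := by
    funext ω
    have e1 : (fun i => if i = k then N.unif k ω else (m' ω i).1) = fun i => N.unif i ω := by
      funext i
      by_cases hik : i = k <;> simp [m', hik]
    have e2 : (fun i => (m' ω i).2) = fun i => if i = k then 0 else N.fading i ω := by
      funext i
      by_cases hik : i = k <;> simp [m', hik]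
    rw [e1, e2]
    rfl
  rw [heq]
  exact h5

/-- Integrating out the channel gain of the serving BS. -/
lemma measure_lt_sinr (h : N.IsModel p μ lam rho) (hp : p.Valid) {γ : ℝ} (hγ : 0 < γ) :
    μ {ω | ENNReal.ofReal γ < N.sinr p ω} =
      ∫⁻ ω, expNeg (N.threshold p γ (N.serving p ω) ω) ∂μ := by
  have hserv := measurable_serving hp h.measurable_bs h.measurable_unif
  have hthr := measurable_threshold hp h.measurable_bs h.measurable_active h.measurable_unif
    h.measurable_fading γ
  -- The serving index is random, so the outcomes are split by its value; on each part a fixed gain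
  -- is integrated out.
  let S : ℕ → Set Ω := fun k => N.serving p ⁻¹' {k}
  have hS : ∀ k, MeasurableSet (S k) := fun k => hserv (measurableSet_singleton k)
  have hSd : Pairwise fun k l => Disjoint (S k) (S l) := fun k l hkl =>
    Set.disjoint_left.2 fun ω hk hl => hkl (Eq.trans (Eq.symm hk) hl)
  have hSu : ⋃ k, S k = univ := iUnion_eq_univ_iff.2 fun ω => ⟨N.serving p ω, rfl⟩
  have hcb : ∀ i, Measurable (canonical.bs i) := fun i => by
    change Measurable fun z : (ℕ → Plane × Bool) × (ℕ → ℝ) × (ℕ → ℝ) => (z.1 i).1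
    fun_prop
  have hca : ∀ i, Measurable (canonical.active i) := fun i => by
    change Measurable fun z : (ℕ → Plane × Bool) × (ℕ → ℝ) × (ℕ → ℝ) => (z.1 i).2
    fun_prop
  have hcu : ∀ i, Measurable (canonical.unif i) := fun i => by
    change Measurable fun z : (ℕ → Plane × Bool) × (ℕ → ℝ) × (ℕ → ℝ) => z.2.1 i
    fun_prop
  have hcf : ∀ i, Measurable (canonical.fading i) := fun i => by
    change Measurable fun z : (ℕ → Plane × Bool) × (ℕ → ℝ) × (ℕ → ℝ) => z.2.2 i
    fun_prop
  have hZ : ∀ k, Measurable (N.valuesExcept k) := fun k => by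
    refine Measurable.prodMk
      (measurable_pi_lambda _ fun i => (h.measurable_bs i).prodMk (h.measurable_active i))
      ((measurable_pi_lambda _ h.measurable_unif).prodMk (measurable_pi_lambda _ fun i => ?_))
    by_cases hik : i = k
    · simp [hik]
    · simpa [hik] using h.measurable_fading i
  have hk : ∀ k, μ {ω | ω ∈ S k ∧ N.threshold p γ k ω < ENNReal.ofReal (N.fading k ω)} =
      ∫⁻ ω in S k, expNeg (N.threshold p γ (N.serving p ω) ω) ∂μ := fun k => by
    -- The serving index ignores all gains, so it too is a function of `valuesExcept k`, namely the
    -- serving index of the canonical network.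
    have := measure_and_lt_ofReal (hZ k) (h.measurable_fading k) (h.indepFun_fading_valuesExcept k)
      (h.fading_law k) (measurable_serving hp hcb hcu (measurableSet_singleton k))
      (measurable_threshold hp hcb hca hcu hcf γ k)
    simp only [canonical_threshold] at this
    refine this.trans (setLIntegral_congr_fun (hS k) fun ω hω => ?_)
    have hω' : N.serving p ω = k := hω
    simp only [hω']
  let T : ℕ → Set Ω := fun k =>
    {ω | ω ∈ S k ∧ N.threshold p γ k ω < ENNReal.ofReal (N.fading k ω)}
  have hT : ∀ k, MeasurableSet (T k) := fun k =>
    (hS k).inter (measurableSet_lt (hthr k) (h.measurable_fading k).ennreal_ofReal)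
  have hTd : Pairwise fun k l => Disjoint (T k) (T l) := fun k l hkl =>
    (hSd hkl).mono (fun _ h => h.1) (fun _ h => h.1)
  have hk : ∀ k, μ (T k) = ∫⁻ ω in S k, expNeg (N.threshold p γ (N.serving p ω) ω) ∂μ := hk
  have hunion : {ω | ENNReal.ofReal γ < N.sinr p ω} = ⋃ k, T k := by
    ext ω
    rw [mem_iUnion]
    refine (lt_sinr_iff hp hγ ω).trans ⟨fun hlt => ⟨_, rfl, hlt⟩, ?_⟩
    rintro ⟨k, hk, hlt⟩
    have hk' : N.serving p ω = k := hk
    rwa [hk']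
  rw [hunion, measure_iUnion hTd hT]
  simp_rw [hk]
  rw [← lintegral_iUnion hS hSd, hSu, Measure.restrict_univ]

end IsModel

end Network

/-! ### Mean effect of a single interferer -/

/-- The Laplace transform of the exponential distribution with mean one. -/
lemma lintegral_expNeg_expMeasure {t : ℝ} (ht : 0 ≤ t) :
    ∫⁻ h, expNeg (ENNReal.ofReal (t * h)) ∂(expMeasure 1) = ENNReal.ofReal (1 / (1 + t)) := by
  have h1t : 0 < 1 + t := by linarith
  have hE : expMeasure 1 = volume.withDensity (exponentialPDF 1) := rfl
  have hm : Measurable (exponentialPDF 1) := (measurable_exponentialPDFReal 1).ennreal_ofReal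
  rw [hE, lintegral_withDensity_eq_lintegral_mul _ hm (by fun_prop)]
  -- Tilting the density by `exp (-t x)` gives the exponential density of rate `1 + t`, up to its
  -- normalization.
  have h : ∀ x, (exponentialPDF 1 * fun h => expNeg (ENNReal.ofReal (t * h))) x =
      ENNReal.ofReal (1 / (1 + t)) * exponentialPDF (1 + t) x := by
    intro x
    rw [Pi.mul_apply]
    rcases lt_or_ge x 0 with hx | hx
    · simp [exponentialPDF_of_neg hx]
    · rw [exponentialPDF_of_nonneg hx, exponentialPDF_of_nonneg hx,
        expNeg_ofReal (mul_nonneg ht hx), ← ENNReal.ofReal_mul (by positivity),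
        ← ENNReal.ofReal_mul (by positivity)]
      congr 1
      rw [show -((1 + t) * x) = -(1 * x) + -(t * x) by ring, Real.exp_add]
      field_simp
  simp_rw [h]
  have hm' : Measurable (exponentialPDF (1 + t)) :=
    (measurable_exponentialPDFReal _).ennreal_ofReal
  rw [lintegral_const_mul _ hm',
    lintegral_exponentialPDF_eq_one h1t, mul_one]

lemma lintegral_Icc_ite_lt {a : ℝ} (ha : a ∈ Icc (0 : ℝ) 1) (x y : ℝ≥0∞) :
    ∫⁻ u in Icc (0 : ℝ) 1, (if u < a then x else y) =
      ENNReal.ofReal a * x + ENNReal.ofReal (1 - a) * y := by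
  have hA : MeasurableSet (Iio a) := measurableSet_Iio
  rw [← lintegral_add_compl _ hA,
    setLIntegral_congr_fun (f := fun u => if u < a then x else y) (g := fun _ => x) hA
      (fun u hu => if_pos hu),
    setLIntegral_congr_fun (f := fun u => if u < a then x else y) (g := fun _ => y) hA.compl
      (fun u hu => if_neg hu),
    setLIntegral_const, setLIntegral_const, Measure.restrict_apply hA,
    Measure.restrict_apply hA.compl]
  have h1 : Iio a ∩ Icc (0 : ℝ) 1 = Ico 0 a := by
    ext u
    simp only [mem_inter_iff, mem_Iio, mem_Icc, mem_Ico]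
    exact ⟨fun h => ⟨h.2.1, h.1⟩, fun h => ⟨h.2, h.1, h.2.le.trans ha.2⟩⟩
  have h2 : (Iio a)ᶜ ∩ Icc (0 : ℝ) 1 = Icc a 1 := by
    ext u
    simp only [mem_inter_iff, mem_compl_iff, mem_Iio, mem_Icc, not_lt]
    exact ⟨fun h => ⟨h.1, h.2.2⟩, fun h => ⟨h.1, ha.1.trans h.1, h.2⟩⟩
  rw [h1, h2, Real.volume_Ico, Real.volume_Icc, sub_zero, mul_comm x, mul_comm y]

/-- The law of the marks: a uniform variable and an exponential one. -/
def markLaw : Measure (ℝ × ℝ) := (volume.restrict (Icc (0 : ℝ) 1)).prod (expMeasure 1)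

instance isProbabilityMeasure_uniform :
    IsProbabilityMeasure ((volume : Measure ℝ).restrict (Icc (0 : ℝ) 1)) :=
  ⟨by simp⟩

instance isProbabilityMeasure_markLaw : IsProbabilityMeasure markLaw := by
  have := isProbabilityMeasure_expMeasure one_pos
  unfold markLaw
  infer_instance

namespace Params

variable (p : Params)

/-- The received power, scaled by `τ`, over a link from `x` with marks `e`. -/
def scaledPower (τ : ℝ) (x : Plane) (e : ℝ × ℝ) : ℝ≥0∞ :=
  ENNReal.ofReal (τ * p.linkLoss x e.1 * e.2)

/-- One minus the mean of `exp (-scaledPower)` at distance `r`. -/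
def attenuation (τ r : ℝ) : ℝ :=
  p.prL (p.dist3 r) * (τ * p.zetaL (p.dist3 r) / (1 + τ * p.zetaL (p.dist3 r))) +
    (1 - p.prL (p.dist3 r)) * (τ * p.zetaNL (p.dist3 r) / (1 + τ * p.zetaNL (p.dist3 r)))

/-- The integral of the attenuation over the plane. -/
def totalAttenuation (τ : ℝ) : ℝ≥0∞ := ∫⁻ x : Plane, ENNReal.ofReal (p.attenuation τ ‖x‖)

lemma measurable_scaledPower (hp : p.Valid) (τ : ℝ) :
    Measurable (Function.uncurry (p.scaledPower τ)) := by
  have h : Measurable fun z : Plane × ℝ × ℝ => p.linkLoss z.1 z.2.1 :=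
    (p.measurable_linkLoss hp).comp (measurable_fst.prodMk (measurable_fst.comp measurable_snd))
  exact ((h.const_mul τ).mul (measurable_snd.comp measurable_snd)).ennreal_ofReal

/-- Averaging the gain first gives `1 / (1 + τ ζ)`; averaging the uniform variable then mixes the
LoS and NLoS values. -/
lemma lintegral_expNeg_scaledPower (hp : p.Valid) {τ : ℝ} (hτ : 0 ≤ τ) (x : Plane) :
    ∫⁻ e, expNeg (p.scaledPower τ x e) ∂markLaw = ENNReal.ofReal (1 - p.attenuation τ ‖x‖) := by
  have := isProbabilityMeasure_expMeasure one_pos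
  have hm : Measurable fun e => expNeg (p.scaledPower τ x e) :=
    ((p.measurable_scaledPower hp τ).comp (measurable_const.prodMk measurable_id)).expNeg
  rw [markLaw, lintegral_prod _ hm.aemeasurable]
  simp only [scaledPower]
  simp_rw [fun u => lintegral_expNeg_expMeasure (mul_nonneg hτ (p.linkLoss_pos hp x u).le)]
  obtain ⟨h0, h1⟩ := hp.prL_mem _ (p.le_dist3 ‖x‖)
  have hite : ∀ u, ENNReal.ofReal (1 / (1 + τ * p.linkLoss x u)) =
      if u < p.prL (p.dist3 ‖x‖) then ENNReal.ofReal (1 / (1 + τ * p.zetaL (p.dist3 ‖x‖)))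
      else ENNReal.ofReal (1 / (1 + τ * p.zetaNL (p.dist3 ‖x‖))) := by
    intro u
    unfold linkLoss
    split_ifs <;> rfl
  simp_rw [hite]
  have hL := p.zetaL_pos hp ‖x‖
  have hNL := p.zetaNL_pos hp ‖x‖
  rw [lintegral_Icc_ite_lt ⟨h0, h1⟩, ← ENNReal.ofReal_mul h0, ← ENNReal.ofReal_mul (by linarith),
    ← ENNReal.ofReal_add (by positivity) (mul_nonneg (by linarith) (by positivity))]
  congr 1
  have h2 : 1 + τ * p.zetaL (p.dist3 ‖x‖) ≠ 0 := by positivity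
  have h3 : 1 + τ * p.zetaNL (p.dist3 ‖x‖) ≠ 0 := by positivity
  rw [attenuation]
  field_simp
  ring

lemma div_one_add_mem {t : ℝ} (ht : 0 ≤ t) : t / (1 + t) ∈ Icc (0 : ℝ) 1 :=
  ⟨by positivity, (div_le_one (by linarith)).2 (by linarith)⟩

lemma attenuation_mem (hp : p.Valid) {τ : ℝ} (hτ : 0 ≤ τ) (r : ℝ) :
    p.attenuation τ r ∈ Icc (0 : ℝ) 1 := by
  obtain ⟨h0, h1⟩ := hp.prL_mem _ (p.le_dist3 r)
  obtain ⟨h2, h3⟩ := div_one_add_mem (mul_nonneg hτ (p.zetaL_pos hp r).le)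
  obtain ⟨h4, h5⟩ := div_one_add_mem (mul_nonneg hτ (p.zetaNL_pos hp r).le)
  unfold attenuation
  constructor
  · exact add_nonneg (mul_nonneg h0 h2) (mul_nonneg (by linarith) h4)
  · nlinarith [mul_le_mul_of_nonneg_left h3 h0, mul_le_mul_of_nonneg_left h5 (sub_nonneg.2 h1)]

lemma measurable_attenuation (hp : p.Valid) (τ : ℝ) : Measurable (p.attenuation τ) := by
  have h1 := p.measurable_prL_dist3 hp
  have h2 := p.measurable_zetaL_dist3.const_mul τ
  have h3 := p.measurable_zetaNL_dist3.const_mul τ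
  exact (h1.mul (h2.div (h2.const_add 1))).add
    ((h1.const_sub 1).mul (h3.div (h3.const_add 1)))

lemma lintegral_one_sub_expNeg_scaledPower (hp : p.Valid) {τ : ℝ} (hτ : 0 ≤ τ) :
    ∫⁻ x : Plane, (1 - ∫⁻ e, expNeg (p.scaledPower τ x e) ∂markLaw) = p.totalAttenuation τ := by
  refine lintegral_congr fun x => ?_
  obtain ⟨-, h1⟩ := p.attenuation_mem hp hτ ‖x‖
  rw [p.lintegral_expNeg_scaledPower hp hτ, ← ENNReal.ofReal_one,
    ← ENNReal.ofReal_sub _ (by linarith), sub_sub_cancel]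

lemma div_one_add_mul_le {c t : ℝ} (hc : 1 ≤ c) (ht : 0 ≤ t) :
    c * t / (1 + c * t) ≤ c * (t / (1 + t)) := by
  rw [mul_div_assoc]
  have : t / (1 + c * t) ≤ t / (1 + t) := by
    gcongr
    nlinarith
  nlinarith

lemma attenuation_mul_le (hp : p.Valid) {c τ : ℝ} (hc : 1 ≤ c) (hτ : 0 ≤ τ) (r : ℝ) :
    p.attenuation (c * τ) r ≤ c * p.attenuation τ r := by
  obtain ⟨h0, h1⟩ := hp.prL_mem _ (p.le_dist3 r)
  have h2 := div_one_add_mul_le hc (mul_nonneg hτ (p.zetaL_pos hp r).le)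
  have h3 := div_one_add_mul_le hc (mul_nonneg hτ (p.zetaNL_pos hp r).le)
  rw [← mul_assoc] at h2 h3
  unfold attenuation
  nlinarith [mul_le_mul_of_nonneg_left h2 h0, mul_le_mul_of_nonneg_left h3 (sub_nonneg.2 h1)]

/-- Inherited from `t / (1 + t)`, whose denominator grows with `t`. It controls the limit `c → 1`
without any continuity in `τ`. -/
lemma totalAttenuation_mul_le (hp : p.Valid) {c τ : ℝ} (hc : 1 ≤ c) (hτ : 0 ≤ τ) :
    p.totalAttenuation (c * τ) ≤ ENNReal.ofReal c * p.totalAttenuation τ := by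
  unfold totalAttenuation
  have hm : Measurable fun x : Plane => ENNReal.ofReal (p.attenuation τ ‖x‖) :=
    ((p.measurable_attenuation hp τ).comp measurable_norm).ennreal_ofReal
  rw [← lintegral_const_mul _ hm]
  refine lintegral_mono fun x => ?_
  rw [← ENNReal.ofReal_mul (by linarith)]
  exact ENNReal.ofReal_le_ofReal (p.attenuation_mul_le hp hc hτ _)

end Params

/-! ### Pathwise bounds on the threshold -/

namespace Network

variable {Ω : Type*} {N : Network Ω} {p : Params}

/-- The total power received from all active BSs, scaled by `τ`. -/
def totalPower (N : Network Ω) (p : Params) (τ : ℝ) (ω : Ω) : ℝ≥0∞ :=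
  ∑' i, if N.active i ω = true then p.scaledPower τ (N.bs i ω) (N.unif i ω, N.fading i ω) else 0

lemma totalPower_mul {c : ℝ} (hc : 0 ≤ c) (τ : ℝ) (ω : Ω) :
    N.totalPower p (c * τ) ω = ENNReal.ofReal c * N.totalPower p τ ω := by
  unfold totalPower
  rw [← ENNReal.tsum_mul_left]
  refine tsum_congr fun i => ?_
  split_ifs
  · rw [Params.scaledPower, Params.scaledPower, ← ENNReal.ofReal_mul hc]
    congr 1
    ring
  · simp

/-- The factor cancels `P` and turns each received power into a scaled power; putting back the
`k`-th BS can only increase the sum. -/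
lemma ofReal_div_mul_interferenceExcept_le (hp : p.Valid) {γ : ℝ} (hγ : 0 < γ) (k : ℕ) (ω : Ω) :
    ENNReal.ofReal (γ / (p.P * p.peak)) * N.interferenceExcept p k ω ≤
      N.totalPower p (γ / p.peak) ω := by
  unfold interferenceExcept totalPower
  have hM := p.peak_pos hp
  have hP := hp.P_pos
  rw [← ENNReal.tsum_mul_left]
  refine ENNReal.tsum_le_tsum fun i => ?_
  by_cases ha : N.active i ω = true
  · by_cases hi : i = k
    · simp [hi]
    · simp only [ha, hi, ne_eq, not_false_eq_true, and_self, if_true]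
      rw [← ENNReal.ofReal_mul (by positivity), Params.scaledPower, ← pathLoss_eq]
      refine le_of_eq (congrArg _ ?_)
      field_simp
  · simp [ha]

lemma ofReal_div_mul_interferenceExcept (hp : p.Valid) {γ : ℝ} (hγ : 0 < γ) {k : ℕ} {ω : Ω}
    (hk : ¬ N.active k ω = true) :
    ENNReal.ofReal (γ / (p.P * p.peak)) * N.interferenceExcept p k ω =
      N.totalPower p (γ / p.peak) ω := by
  refine le_antisymm (ofReal_div_mul_interferenceExcept_le hp hγ k ω) ?_
  unfold interferenceExcept totalPower
  have hM := p.peak_pos hp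
  have hP := hp.P_pos
  rw [← ENNReal.tsum_mul_left]
  refine ENNReal.tsum_le_tsum fun i => ?_
  by_cases ha : N.active i ω = true
  · have hi : i ≠ k := by
      rintro rfl
      exact hk ha
    simp only [ha, hi, ne_eq, not_false_eq_true, and_self, if_true]
    rw [← ENNReal.ofReal_mul (by positivity), Params.scaledPower, ← pathLoss_eq]
    refine le_of_eq (congrArg _ ?_)
    field_simp
  · simp [ha]

lemma threshold_eq (hp : p.Valid) (γ : ℝ) (k : ℕ) (ω : Ω) :
    N.threshold p γ k ω = ENNReal.ofReal (γ / (p.P * N.pathLoss p k ω)) *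
      (ENNReal.ofReal p.PN + N.interferenceExcept p k ω) := by
  have h : 0 < p.P * N.pathLoss p k ω := mul_pos hp.P_pos (p.linkLoss_pos hp _ _)
  rw [threshold, ENNReal.ofReal_div_of_pos h]
  simp only [div_eq_mul_inv]
  ring

/-- The threshold is at least its value for the strongest possible serving link. -/
lemma le_threshold (hp : p.Valid) {γ : ℝ} (hγ : 0 < γ) {k : ℕ} {ω : Ω}
    (hk : ¬ N.active k ω = true) :
    ENNReal.ofReal (p.PN * γ / (p.P * p.peak)) + N.totalPower p (γ / p.peak) ω ≤
      N.threshold p γ k ω := by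
  have hM := p.peak_pos hp
  have hP := hp.P_pos
  have hl : 0 < N.pathLoss p k ω := p.linkLoss_pos hp _ _
  rw [← ofReal_div_mul_interferenceExcept hp hγ hk, mul_div_assoc, ENNReal.ofReal_mul hp.PN_nonneg,
    mul_comm (ENNReal.ofReal p.PN), ← mul_add, threshold_eq hp]
  gcongr
  exact p.linkLoss_le_peak hp _ _

/-- A path loss of at least `peak / c` costs at most a factor `c`. Activity of the `k`-th BS is
irrelevant here, since counting it as an interferer only weakens the bound. -/
lemma threshold_le (hp : p.Valid) {γ : ℝ} (hγ : 0 < γ) {c : ℝ} (hc : 0 < c) {k : ℕ} {ω : Ω}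
    (hk : p.peak ≤ c * N.pathLoss p k ω) :
    N.threshold p γ k ω ≤ ENNReal.ofReal (c * (p.PN * γ / (p.P * p.peak))) +
      N.totalPower p (c * (γ / p.peak)) ω := by
  have hM := p.peak_pos hp
  have hP := hp.P_pos
  have hl : 0 < N.pathLoss p k ω := p.linkLoss_pos hp _ _
  rw [totalPower_mul hc.le, ENNReal.ofReal_mul hc.le, ← mul_add]
  calc N.threshold p γ k ω
      = ENNReal.ofReal (γ / (p.P * N.pathLoss p k ω)) *
          (ENNReal.ofReal p.PN + N.interferenceExcept p k ω) := threshold_eq hp _ _ _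
    _ ≤ ENNReal.ofReal (c * (γ / (p.P * p.peak))) *
          (ENNReal.ofReal p.PN + N.interferenceExcept p k ω) := by
        gcongr
        rw [← mul_div_assoc, div_le_div_iff₀ (by positivity) (by positivity)]
        have := mul_le_mul_of_nonneg_left hk (mul_pos hγ hP).le
        nlinarith
    _ ≤ _ := by
        rw [ENNReal.ofReal_mul hc.le, mul_assoc, mul_add, ← ENNReal.ofReal_mul (by positivity),
          div_mul_eq_mul_div, mul_comm γ]
        gcongr
        exact ofReal_div_mul_interferenceExcept_le hp hγ k ω

end Network

/-! ### Limit of the active density -/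

namespace Params

variable {p : Params}

lemma activeDensity_nonneg (hp : p.Valid) {lam rho : ℝ} (hlam : 0 < lam) (hrho : 0 < rho) :
    0 ≤ p.activeDensity lam rho := by
  have hq := hp.q_pos
  have h1 : 1 ≤ (1 + rho / (p.q * lam)) ^ p.q :=
    Real.one_le_rpow (le_add_of_nonneg_right (by positivity)) hq.le
  exact mul_nonneg hlam.le (sub_nonneg.2 ((div_le_one (by linarith)).2 h1))

/-- With `t = 1 / lam` the density is the difference quotient at `0` of `-(1 + rho t / q) ^ (-q)`,
whose derivative there is `rho`. -/
lemma tendsto_activeDensity (hp : p.Valid) (rho : ℝ) :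
    Tendsto (fun lam => p.activeDensity lam rho) atTop (𝓝 rho) := by
  have hq := hp.q_pos
  have hd : HasDerivAt (fun t : ℝ => -((1 + rho / p.q * t) ^ p.q)⁻¹) rho 0 := by
    have h1 : HasDerivAt (fun t : ℝ => 1 + rho / p.q * t) (rho / p.q) 0 := by
      simpa using ((hasDerivAt_id (0 : ℝ)).const_mul (rho / p.q)).const_add 1
    refine ((h1.rpow_const (p := p.q) (Or.inl (by simp))).fun_inv (by simp)).fun_neg.congr_deriv ?_
    simp only [mul_zero, add_zero, Real.one_rpow]
    field_simp
  have h3 := hd.tendsto_slope_zero_right.comp tendsto_inv_atTop_nhdsGT_zero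
  refine h3.congr' ?_
  filter_upwards [eventually_gt_atTop 0] with lam hlam
  simp only [Function.comp, activeDensity, smul_eq_mul, inv_inv, zero_add, mul_zero, add_zero,
    Real.one_rpow]
  have : rho / p.q * lam⁻¹ = rho / (p.q * lam) := by
    field_simp
  rw [this]
  ring

end Params

/-! ### The serving link, and coverage bounds at finite density -/

namespace Network

variable {Ω : Type*} {N : Network Ω} {p : Params}

lemma bsSet_eq_pointSet : N.bsSet = pointSet (fun _ _ => true) N.bs := by
  funext ω
  ext y
  simp [bsSet, pointSet]

/-- Only BSs at least as strong as BS `0` compete. They lie in a bounded region, so there are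
finitely many of them. -/
lemma exists_forall_pathLoss_le (hp : p.Valid) {ω : Ω}
    (hinj : Function.Injective fun i => N.bs i ω)
    (hfin : ∀ n : ℕ, (N.bsSet ω ∩ Metric.ball 0 n).Finite) :
    ∃ i, ∀ j, N.pathLoss p j ω ≤ N.pathLoss p i ω := by
  have h0 : 0 < N.pathLoss p 0 ω := p.linkLoss_pos hp _ _
  have hM := p.peak_pos hp
  -- With `c = peak / pathLoss 0`, the strength condition says that the path loss is at least that
  -- of BS `0`.
  obtain ⟨R, hR⟩ := (p.isBounded_strongRegion hp (div_pos hM h0)).subset_ball 0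
  obtain ⟨n, hn⟩ := exists_nat_ge R
  have hsub : {j | N.pathLoss p 0 ω ≤ N.pathLoss p j ω} ⊆
      (fun i => N.bs i ω) ⁻¹' (N.bsSet ω ∩ Metric.ball 0 n) := by
    intro j hj
    refine ⟨⟨j, rfl⟩, Metric.ball_subset_ball hn (hR (p.mem_strongRegion (u := N.unif j ω) ?_))⟩
    rw [← pathLoss_eq, div_mul_eq_mul_div, le_div_iff₀ h0]
    exact mul_le_mul_of_nonneg_left hj hM.le
  have hfin' : {j | N.pathLoss p 0 ω ≤ N.pathLoss p j ω}.Finite :=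
    ((hfin n).preimage hinj.injOn).subset hsub
  obtain ⟨i, hi, hmax⟩ := exists_max_image _ (fun j => N.pathLoss p j ω) hfin'
    ⟨0, le_refl (N.pathLoss p 0 ω)⟩
  refine ⟨i, fun j => ?_⟩
  by_cases hj : N.pathLoss p 0 ω ≤ N.pathLoss p j ω
  · exact hmax j hj
  · exact (not_le.1 hj).le.trans hi

lemma pathLoss_le_serving {ω : Ω} (h : ∃ i, ∀ j, N.pathLoss p j ω ≤ N.pathLoss p i ω) (j : ℕ) :
    N.pathLoss p j ω ≤ N.pathLoss p (N.serving p ω) ω :=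
  Nat.sInf_mem (s := {i | ∀ j, N.pathLoss p j ω ≤ N.pathLoss p i ω}) h j

namespace IsModel

variable [MeasurableSpace Ω] {μ : Measure Ω} {lam rho : ℝ}

lemma measurable_mark (h : N.IsModel p μ lam rho) (i : ℕ) :
    Measurable fun ω => (N.unif i ω, N.fading i ω) :=
  (h.measurable_unif i).prodMk (h.measurable_fading i)

lemma measurableSet_exists_active (h : N.IsModel p μ lam rho) {R : Set Plane}
    (hR : MeasurableSet R) : MeasurableSet {ω | ∃ i, N.active i ω = true ∧ N.bs i ω ∈ R} := by
  have : {ω | ∃ i, N.active i ω = true ∧ N.bs i ω ∈ R} =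
      ⋃ i, (N.active i ⁻¹' {true} ∩ N.bs i ⁻¹' R) := by
    ext ω
    simp
  rw [this]
  exact MeasurableSet.iUnion fun i =>
    (h.measurable_active i (measurableSet_singleton _)).inter (h.measurable_bs i hR)

lemma measurable_totalPower (h : N.IsModel p μ lam rho) (hp : p.Valid) (τ : ℝ) :
    Measurable (N.totalPower p τ) :=
  Measurable.tsum fun i => Measurable.ite (h.measurable_active i (measurableSet_singleton true))
    ((p.measurable_scaledPower hp τ).comp ((h.measurable_bs i).prodMk (h.measurable_mark i)))
    measurable_const

variable [IsProbabilityMeasure μ]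

lemma map_mark (h : N.IsModel p μ lam rho) (i : ℕ) :
    μ.map (fun ω => (N.unif i ω, N.fading i ω)) = markLaw := by
  have := isProbabilityMeasure_expMeasure one_pos
  have := Measure.isProbabilityMeasure_map (μ := μ) (h.measurable_fading i).aemeasurable
  rw [(indepFun_iff_map_prod_eq_prod_map_map (h.measurable_unif i).aemeasurable
    (h.measurable_fading i).aemeasurable).1 (h.unif_indep_fading i), h.unif_law, h.fading_law,
    markLaw]

lemma lintegral_expNeg_active (h : N.IsModel p μ lam rho) (hd : 0 ≤ p.activeDensity lam rho)
    {F : Plane → ℝ × ℝ → ℝ≥0∞} (hF : Measurable (Function.uncurry F)) :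
    ∫⁻ ω, expNeg (∑' i, if N.active i ω = true then F (N.bs i ω) (N.unif i ω, N.fading i ω)
      else 0) ∂μ = expNeg (ENNReal.ofReal (p.activeDensity lam rho) *
        ∫⁻ y, (1 - ∫⁻ e, expNeg (F y e) ∂markLaw)) :=
  h.active_poisson.lintegral_expNeg_marked h.measurable_active h.measurable_bs h.bs_injective hd
    h.measurable_mark h.map_mark h.marks_indep h.marks_indep_bs hF

lemma lintegral_expNeg_all (h : N.IsModel p μ lam rho) (hlam : 0 ≤ lam)
    {F : Plane → ℝ × ℝ → ℝ≥0∞} (hF : Measurable (Function.uncurry F)) :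
    ∫⁻ ω, expNeg (∑' i, F (N.bs i ω) (N.unif i ω, N.fading i ω)) ∂μ =
      expNeg (ENNReal.ofReal lam * ∫⁻ y, (1 - ∫⁻ e, expNeg (F y e) ∂markLaw)) := by
  have hP := h.bs_poisson
  rw [bsSet_eq_pointSet] at hP
  have hm : Measurable fun (z : ℕ → Plane × Bool) (i : ℕ) => ((z i).1, true) := by
    refine measurable_pi_lambda _ fun i => ?_
    fun_prop
  have := hP.lintegral_expNeg_marked (fun _ => measurable_const) h.measurable_bs h.bs_injective
    hlam h.measurable_mark h.map_mark h.marks_indep (h.marks_indep_bs.comp hm measurable_id) hF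
  simpa using this

/-- The probability that some active BS lies in a given region. -/
lemma measure_exists_active (h : N.IsModel p μ lam rho) (hd : 0 ≤ p.activeDensity lam rho)
    {R : Set Plane} (hR : MeasurableSet R) :
    μ {ω | ∃ i, N.active i ω = true ∧ N.bs i ω ∈ R} =
      1 - expNeg (ENNReal.ofReal (p.activeDensity lam rho) * volume R) := by
  -- Weight `∞` on `R` makes `expNeg` of the point sum the indicator of the absence of active BSs in
  -- `R`, so the Laplace functional becomes the void probability.
  have hF : Measurable (Function.uncurry fun (x : Plane) (_ : ℝ × ℝ) =>
      R.indicator (fun _ => (∞ : ℝ≥0∞)) x) :=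
    (measurable_const.indicator hR).comp measurable_fst
  have h1 := h.lintegral_expNeg_active hd hF
  have h2 : ∀ y : Plane, 1 - ∫⁻ _ : ℝ × ℝ, expNeg (R.indicator (fun _ => (∞ : ℝ≥0∞)) y) ∂markLaw =
      R.indicator 1 y := by
    intro y
    by_cases hy : y ∈ R <;> simp [hy]
  simp_rw [h2] at h1
  rw [lintegral_indicator_one hR] at h1
  have hA := h.measurableSet_exists_active hR
  rw [← h1, ← compl_compl {ω | ∃ i, N.active i ω = true ∧ N.bs i ω ∈ R}, prob_compl_eq_one_sub
    hA.compl, ← lintegral_indicator_one hA.compl]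
  congr 1
  refine lintegral_congr fun ω => ?_
  by_cases hω : ∃ i, N.active i ω = true ∧ N.bs i ω ∈ R
  · rw [indicator_of_notMem (by simpa using hω)]
    obtain ⟨i, hi, hiR⟩ := hω
    have : ∑' i, (if N.active i ω = true then R.indicator (fun _ => (∞ : ℝ≥0∞)) (N.bs i ω) else 0)
        = ∞ := ENNReal.tsum_eq_top_of_eq_top ⟨i, by simp [hi, hiR]⟩
    rw [this, expNeg_top]
  · rw [indicator_of_mem (by simpa using hω)]
    have : ∀ i, (if N.active i ω = true then R.indicator (fun _ => (∞ : ℝ≥0∞)) (N.bs i ω) else 0)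
        = 0 := fun i => by
      split_ifs with hi
      · exact indicator_of_notMem (fun hiR => hω ⟨i, hi, hiR⟩) _
      · rfl
    simp [this]

lemma ae_exists_forall_pathLoss_le (h : N.IsModel p μ lam rho) (hp : p.Valid) (hlam : 0 ≤ lam) :
    ∀ᵐ ω ∂μ, ∃ i, ∀ j, N.pathLoss p j ω ≤ N.pathLoss p i ω := by
  have hP := h.bs_poisson
  rw [bsSet_eq_pointSet] at hP
  have hfin : ∀ᵐ ω ∂μ, ∀ n : ℕ, (N.bsSet ω ∩ Metric.ball 0 n).Finite := by
    rw [bsSet_eq_pointSet]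
    exact ae_all_iff.2 fun n => hP.ae_finite_inter (fun _ => measurable_const) h.measurable_bs
      h.bs_injective hlam measurableSet_ball Metric.isBounded_ball
  filter_upwards [hfin] with ω hω using exists_forall_pathLoss_le hp (h.bs_injective ω) hω

/-- The serving link is unlikely to be weak. -/
lemma measure_weak_serving_le (h : N.IsModel p μ lam rho) (hp : p.Valid) (hlam : 0 ≤ lam)
    {c r a : ℝ} (hc : 0 < c) (ha : a ∈ Icc (0 : ℝ) 1)
    (hball : ∀ x ∈ Metric.ball (0 : Plane) r,
      a ≤ p.prL (p.dist3 ‖x‖) ∧ p.peak ≤ c * p.zetaL (p.dist3 ‖x‖)) :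
    μ {ω | ¬ p.peak ≤ c * N.pathLoss p (N.serving p ω) ω} ≤
      expNeg (ENNReal.ofReal lam * (ENNReal.ofReal a * volume (Metric.ball (0 : Plane) r))) := by
  let B := Metric.ball (0 : Plane) r
  -- A BS with position and marks in `D` has an LoS link of path loss at least `peak / c`, so a weak
  -- serving link forces `D` to be empty. Weight `∞` on `D` yields this void probability.
  let D : Set (Plane × ℝ × ℝ) := {z | z.1 ∈ B ∧ z.2.1 < a}
  have hD : MeasurableSet D := (measurable_fst measurableSet_ball).inter
    (measurableSet_lt (measurable_fst.comp measurable_snd) measurable_const)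
  let F : Plane → ℝ × ℝ → ℝ≥0∞ := fun x e => D.indicator (fun _ => ∞) (x, e)
  have hF : Measurable (Function.uncurry F) := measurable_const.indicator hD
  have h1 := h.lintegral_expNeg_all hlam hF
  have h2 : ∀ y : Plane, 1 - ∫⁻ e, expNeg (F y e) ∂markLaw =
      B.indicator (fun _ => ENNReal.ofReal a) y := by
    intro y
    have := isProbabilityMeasure_expMeasure one_pos
    by_cases hy : y ∈ B
    · have h3 : ∀ e : ℝ × ℝ, expNeg (F y e) = if e.1 < a then 0 else 1 := fun e => by
        by_cases he : e.1 < a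
        · have : (y, e) ∈ D := ⟨hy, he⟩
          simp [F, this, he]
        · have : (y, e) ∉ D := fun hm => he hm.2
          simp [F, this, he]
      simp_rw [h3]
      have hm : Measurable fun e : ℝ × ℝ => if e.1 < a then (0 : ℝ≥0∞) else 1 :=
        Measurable.ite (measurableSet_lt measurable_fst measurable_const) measurable_const
          measurable_const
      have h4 : ∫⁻ e, (if e.1 < a then (0 : ℝ≥0∞) else 1) ∂markLaw =
          ∫⁻ u in Icc (0 : ℝ) 1, if u < a then 0 else 1 := by
        rw [markLaw, lintegral_prod _ hm.aemeasurable]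
        refine lintegral_congr fun u => ?_
        by_cases hu : u < a <;> simp [hu]
      rw [h4, lintegral_Icc_ite_lt ha, indicator_of_mem hy, mul_zero, zero_add, mul_one,
        ← ENNReal.ofReal_one, ← ENNReal.ofReal_sub _ (by linarith [ha.2]), sub_sub_cancel]
    · have h3 : ∀ e : ℝ × ℝ, expNeg (F y e) = 1 := fun e => by
        have : (y, e) ∉ D := fun hm => hy hm.1
        simp [F, this]
      simp [h3, hy]
  simp_rw [h2] at h1
  rw [lintegral_indicator measurableSet_ball, setLIntegral_const] at h1
  rw [← h1]
  have hserv := measurable_serving hp h.measurable_bs h.measurable_unif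
  have hpl : Measurable fun ω => N.pathLoss p (N.serving p ω) ω := by
    have : Measurable fun z : ℕ × Ω => N.pathLoss p z.1 z.2 :=
      measurable_from_prod_countable_right fun i =>
        measurable_pathLoss hp h.measurable_bs h.measurable_unif i
    exact this.comp (hserv.prodMk measurable_id)
  have hW : MeasurableSet {ω | ¬ p.peak ≤ c * N.pathLoss p (N.serving p ω) ω} :=
    (measurableSet_le measurable_const (hpl.const_mul c)).compl
  rw [← lintegral_indicator_one hW]
  refine lintegral_mono_ae ?_
  filter_upwards [h.ae_exists_forall_pathLoss_le hp hlam] with ω hω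
  by_cases hw : p.peak ≤ c * N.pathLoss p (N.serving p ω) ω
  · rw [indicator_of_notMem (by simpa using hw)]
    exact zero_le
  · have h0 : ∀ i, F (N.bs i ω) (N.unif i ω, N.fading i ω) = 0 := fun i => by
      refine indicator_of_notMem (fun hm => hw ?_) _
      obtain ⟨hb, hu⟩ := hm
      obtain ⟨h3, h4⟩ := hball _ hb
      have h5 : N.pathLoss p i ω = p.zetaL (p.dist3 ‖N.bs i ω‖) :=
        if_pos (hu.trans_le h3)
      rw [← h5] at h4
      exact h4.trans (mul_le_mul_of_nonneg_left (pathLoss_le_serving hω i) hc.le)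
    simp only [h0, tsum_zero, expNeg_zero]
    exact indicator_le_self' (fun _ _ => zero_le) ω

lemma lintegral_expNeg_totalPower (h : N.IsModel p μ lam rho) (hp : p.Valid)
    (hd : 0 ≤ p.activeDensity lam rho) {τ : ℝ} (hτ : 0 ≤ τ) :
    ∫⁻ ω, expNeg (N.totalPower p τ ω) ∂μ =
      expNeg (ENNReal.ofReal (p.activeDensity lam rho) * p.totalAttenuation τ) := by
  rw [← p.lintegral_one_sub_expNeg_scaledPower hp hτ]
  exact h.lintegral_expNeg_active hd (p.measurable_scaledPower hp τ)

/-- If the serving link is strong and no active BS lies in the strong region, the serving BS is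
inactive and `le_threshold` applies. The two exceptional events are paid for by their probabilities.
-/
lemma measure_coverage_le (h : N.IsModel p μ lam rho) (hp : p.Valid)
    (hd : 0 ≤ p.activeDensity lam rho) {γ : ℝ} (hγ : 0 < γ) (c : ℝ) :
    μ {ω | ENNReal.ofReal γ < N.sinr p ω} ≤
      expNeg (ENNReal.ofReal (p.PN * γ / (p.P * p.peak)) +
        ENNReal.ofReal (p.activeDensity lam rho) * p.totalAttenuation (γ / p.peak)) +
      (μ {ω | ¬ p.peak ≤ c * N.pathLoss p (N.serving p ω) ω} +
        (1 - expNeg (ENNReal.ofReal (p.activeDensity lam rho) * volume (p.strongRegion c)))) := by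
  have hτ : 0 ≤ γ / p.peak := (div_pos hγ (p.peak_pos hp)).le
  let K := ENNReal.ofReal (p.PN * γ / (p.P * p.peak))
  let A := {ω | ¬ p.peak ≤ c * N.pathLoss p (N.serving p ω) ω}
  let B := {ω | ∃ i, N.active i ω = true ∧ N.bs i ω ∈ p.strongRegion c}
  have hm := (h.measurable_totalPower hp (γ / p.peak)).expNeg
  rw [h.measure_lt_sinr hp hγ, ← h.measure_exists_active hd (p.measurableSet_strongRegion c),
    expNeg_add, ← h.lintegral_expNeg_totalPower hp hd hτ, ← lintegral_const_mul _ hm]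
  calc ∫⁻ ω, expNeg (N.threshold p γ (N.serving p ω) ω) ∂μ
      ≤ ∫⁻ ω, (expNeg K * expNeg (N.totalPower p (γ / p.peak) ω) +
          (A.indicator 1 ω + B.indicator 1 ω)) ∂μ := by
        refine lintegral_mono fun ω => ?_
        by_cases hA : ω ∈ A
        · rw [indicator_of_mem hA]
          exact (expNeg_le_one _).trans (le_add_left (le_add_right le_rfl))
        by_cases hB : ω ∈ B
        · rw [indicator_of_mem hB]
          exact (expNeg_le_one _).trans (le_add_left (le_add_left le_rfl))
        refine le_add_right ?_
        rw [← expNeg_add]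
        refine expNeg_antitone (le_threshold hp hγ fun hact => hB ⟨_, hact, ?_⟩)
        exact p.mem_strongRegion (u := N.unif (N.serving p ω) ω) (not_not.1 hA)
    _ = ∫⁻ ω, expNeg K * expNeg (N.totalPower p (γ / p.peak) ω) ∂μ +
          ∫⁻ ω, (A.indicator 1 ω + B.indicator 1 ω) ∂μ :=
        lintegral_add_left (hm.const_mul _) _
    _ ≤ _ := by
        gcongr
        rw [lintegral_add_right _ (measurable_one.indicator
          (h.measurableSet_exists_active (p.measurableSet_strongRegion c)))]
        exact add_le_add (lintegral_indicator_one_le _) (lintegral_indicator_one_le _)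

/-- Here a strong serving link suffices, by `threshold_le`; `totalAttenuation_mul_le` then pulls the
factor `c` out of the attenuation. -/
lemma le_measure_coverage_add (h : N.IsModel p μ lam rho) (hp : p.Valid)
    (hd : 0 ≤ p.activeDensity lam rho) {γ : ℝ} (hγ : 0 < γ) {c : ℝ} (hc : 1 ≤ c) :
    expNeg (ENNReal.ofReal c * (ENNReal.ofReal (p.PN * γ / (p.P * p.peak)) +
        ENNReal.ofReal (p.activeDensity lam rho) * p.totalAttenuation (γ / p.peak))) ≤
      μ {ω | ENNReal.ofReal γ < N.sinr p ω} +
        μ {ω | ¬ p.peak ≤ c * N.pathLoss p (N.serving p ω) ω} := by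
  have hτ : 0 ≤ γ / p.peak := (div_pos hγ (p.peak_pos hp)).le
  have hc0 : 0 < c := by linarith
  let A := {ω | ¬ p.peak ≤ c * N.pathLoss p (N.serving p ω) ω}
  have hm := (h.measurable_totalPower hp (c * (γ / p.peak))).expNeg
  have hthr : Measurable fun ω => N.threshold p γ (N.serving p ω) ω := by
    have : Measurable fun z : ℕ × Ω => N.threshold p γ z.1 z.2 :=
      measurable_from_prod_countable_right fun i =>
        measurable_threshold hp h.measurable_bs h.measurable_active h.measurable_unif
          h.measurable_fading γ i
    exact this.comp ((measurable_serving hp h.measurable_bs h.measurable_unif).prodMk measurable_id)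
  calc _ ≤ expNeg (ENNReal.ofReal (c * (p.PN * γ / (p.P * p.peak)))) *
        expNeg (ENNReal.ofReal (p.activeDensity lam rho) *
          p.totalAttenuation (c * (γ / p.peak))) := by
        rw [← expNeg_add]
        refine expNeg_antitone ?_
        rw [mul_add, ENNReal.ofReal_mul hc0.le, mul_left_comm]
        gcongr
        exact p.totalAttenuation_mul_le hp hc hτ
    _ = ∫⁻ ω, expNeg (ENNReal.ofReal (c * (p.PN * γ / (p.P * p.peak))) +
          N.totalPower p (c * (γ / p.peak)) ω) ∂μ := by
        simp_rw [expNeg_add]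
        rw [← h.lintegral_expNeg_totalPower hp hd (mul_nonneg hc0.le hτ),
          lintegral_const_mul _ hm]
    _ ≤ ∫⁻ ω, (expNeg (N.threshold p γ (N.serving p ω) ω) + A.indicator 1 ω) ∂μ := by
        refine lintegral_mono fun ω => ?_
        by_cases hA : ω ∈ A
        · rw [indicator_of_mem hA]
          exact (expNeg_le_one _).trans (le_add_left le_rfl)
        · exact le_add_right (expNeg_antitone (threshold_le hp hγ hc0 (not_not.1 hA)))
    _ = ∫⁻ ω, expNeg (N.threshold p γ (N.serving p ω) ω) ∂μ + ∫⁻ ω, A.indicator 1 ω ∂μ :=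
        lintegral_add_left hthr.expNeg _
    _ ≤ _ := by
        rw [h.measure_lt_sinr hp hγ]
        gcongr
        exact lintegral_indicator_one_le _

end IsModel

end Network

/-! ### Closed form of the limit -/

namespace Params

variable {p : Params} {γ : ℝ}

lemma losIntegrand_add_nlosIntegrand (hp : p.Valid) (hγ : 0 < γ) (u : ℝ) :
    p.losIntegrand γ u + p.nlosIntegrand γ u = u * p.attenuation (γ / p.peak) u := by
  have hM := p.peak_pos hp
  have hs : p.s γ * p.P = γ / p.peak := by
    have hP := hp.P_pos
    rw [s, ← peak]
    field_simp
  have hL : 0 < γ / p.peak * p.zetaL (p.dist3 u) :=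
    mul_pos (div_pos hγ hM) (p.zetaL_pos hp u)
  have hNL : 0 < γ / p.peak * p.zetaNL (p.dist3 u) :=
    mul_pos (div_pos hγ hM) (p.zetaNL_pos hp u)
  have hinv : ∀ t : ℝ, 0 < t → t / (1 + t) = 1 / (1 + t⁻¹) := fun t ht => by
    field_simp
    rw [add_comm]
  rw [losIntegrand, nlosIntegrand, attenuation, hs, hinv _ hL, hinv _ hNL]
  ring

/-- Polar coordinates for a radial function; the factor `2 π` is the dimension times the area of the
unit disc. -/
lemma totalAttenuation_eq (hp : p.Valid) (hγ : 0 < γ)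
    (hLoS : IntegrableOn (p.losIntegrand γ) (Ioi 0))
    (hNLoS : IntegrableOn (p.nlosIntegrand γ) (Ioi 0)) :
    p.totalAttenuation (γ / p.peak) = ENNReal.ofReal
      (2 * Real.pi * ((∫ u in Ioi (0 : ℝ), p.losIntegrand γ u) +
        ∫ u in Ioi (0 : ℝ), p.nlosIntegrand γ u)) := by
  have hτ : 0 ≤ γ / p.peak := (div_pos hγ (p.peak_pos hp)).le
  have hdim : Module.finrank ℝ Plane = 2 := by simp
  have hvol : volume.real (Metric.ball (0 : Plane) 1) = Real.pi := by
    rw [Measure.real, EuclideanSpace.volume_ball_fin_two]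
    simp [Real.pi_pos.le]
  have hint : IntegrableOn (fun u => u * p.attenuation (γ / p.peak) u) (Ioi 0) := by
    have := hLoS.add hNLoS
    refine this.congr_fun (fun u _ => ?_) measurableSet_Ioi
    exact losIntegrand_add_nlosIntegrand hp hγ u
  have hint2 : Integrable fun x : Plane => p.attenuation (γ / p.peak) ‖x‖ := by
    rw [integrable_fun_norm_addHaar, hdim]
    simpa using hint
  rw [totalAttenuation, ← ofReal_integral_eq_lintegral_ofReal hint2
    (ae_of_all _ fun x => (p.attenuation_mem hp hτ _).1), integral_fun_norm_addHaar volume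
      (p.attenuation (γ / p.peak)), hdim, hvol, ← integral_add hLoS hNLoS]
  congr 1
  simp_rw [losIntegrand_add_nlosIntegrand hp hγ]
  simp only [nsmul_eq_mul, smul_eq_mul]
  norm_num
  ring

lemma setIntegral_losIntegrand_pos (hp : p.Valid) (hγ : 0 < γ)
    (hLoS : IntegrableOn (p.losIntegrand γ) (Ioi 0)) :
    0 < ∫ u in Ioi (0 : ℝ), p.losIntegrand γ u := by
  have hs : 0 < p.s γ * p.P := by
    have := mul_pos hp.P_pos (p.peak_pos hp)
    exact mul_pos (div_pos hγ this) hp.P_pos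
  have hden : ∀ u, 0 < 1 + (p.s γ * p.P * p.zetaL (p.dist3 u))⁻¹ := fun u => by
    have := mul_pos hs (p.zetaL_pos hp u)
    positivity
  rw [setIntegral_pos_iff_support_of_nonneg_ae _ hLoS]
  -- Only the lower bound on the LoS probability near the origin is needed; any constant above one
  -- would do.
  · obtain ⟨r, hr, a, ha, -, hball⟩ := p.exists_ball_strong hp (one_lt_two)
    refine lt_of_lt_of_le ?_ (measure_mono (s := Ioo 0 r) fun u hu => ?_)
    · simpa using hr
    · refine ⟨ne_of_gt (div_pos (mul_pos ?_ hu.1) (hden u)), hu.1⟩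
      have hnorm : ‖EuclideanSpace.single (0 : Fin 2) u‖ = u := by
        simp [abs_of_pos hu.1]
      have := (hball (EuclideanSpace.single 0 u) (by
        rw [mem_ball_zero_iff, hnorm]; exact hu.2)).1
      rw [hnorm] at this
      exact ha.trans_le this
  · refine (ae_restrict_iff' measurableSet_Ioi).2 (ae_of_all _ fun u hu => ?_)
    exact div_nonneg (mul_nonneg (hp.prL_mem _ (p.le_dist3 u)).1 (le_of_lt hu)) (hden u).le

lemma setIntegral_nlosIntegrand_nonneg (hp : p.Valid) (hγ : 0 < γ) :
    0 ≤ ∫ u in Ioi (0 : ℝ), p.nlosIntegrand γ u := by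
  have hs : 0 < p.s γ * p.P := by
    have := mul_pos hp.P_pos (p.peak_pos hp)
    exact mul_pos (div_pos hγ this) hp.P_pos
  refine setIntegral_nonneg measurableSet_Ioi fun u hu => ?_
  have := mul_pos hs (p.zetaNL_pos hp u)
  exact div_nonneg (mul_nonneg (sub_nonneg.2 (hp.prL_mem _ (p.le_dist3 u)).2) (le_of_lt hu))
    (by positivity)

lemma c_mul_g_rpow (γ rho : ℝ) : p.c γ * p.g γ ^ rho =
    Real.exp (-(p.PN * γ / (p.P * p.peak) + rho * (2 * Real.pi *
      ((∫ u in Ioi (0 : ℝ), p.losIntegrand γ u) + ∫ u in Ioi (0 : ℝ), p.nlosIntegrand γ u)))) := by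
  rw [c, g, ← Real.exp_add, ← Real.exp_mul, ← Real.exp_add, ← peak]
  congr 1
  ring

end Params

/-! ### The limit of large BS density -/

namespace Network

lemma tendsto_expNeg_ofReal_mul_atTop {x : ℝ≥0∞} (hx : x ≠ 0) :
    Tendsto (fun lam : ℝ => expNeg (ENNReal.ofReal lam * x)) atTop (𝓝 0) := by
  have h : Tendsto (fun lam : ℝ => ENNReal.ofReal lam * x) atTop (𝓝 (∞ * x)) :=
    ENNReal.Tendsto.mul_const ENNReal.tendsto_ofReal_atTop (Or.inl ENNReal.top_ne_zero)
  rw [ENNReal.top_mul hx] at h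
  simpa [Function.comp_def] using (continuous_expNeg.tendsto ∞).comp h

variable {p : Params} {γ rho : ℝ} {Ω : ℝ → Type*} [∀ lam, MeasurableSpace (Ω lam)]
  {μ : ∀ lam, Measure (Ω lam)} [∀ lam, IsProbabilityMeasure (μ lam)] {N : ∀ lam, Network (Ω lam)}

lemma tendsto_measure_weak_serving (hp : p.Valid)
    (hN : ∀ lam, 0 < lam → (N lam).IsModel p (μ lam) lam rho) {c : ℝ} (hc : 1 < c) :
    Tendsto (fun lam => μ lam
      {ω | ¬ p.peak ≤ c * (N lam).pathLoss p ((N lam).serving p ω) ω}) atTop (𝓝 0) := by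
  obtain ⟨r, hr, a, ha, ha1, hball⟩ := p.exists_ball_strong hp hc
  have hne : ENNReal.ofReal a * volume (Metric.ball (0 : Plane) r) ≠ 0 :=
    mul_ne_zero (ENNReal.ofReal_pos.2 ha).ne' (Metric.measure_ball_pos _ _ hr).ne'
  refine tendsto_of_tendsto_of_tendsto_of_le_of_le' tendsto_const_nhds
    (tendsto_expNeg_ofReal_mul_atTop hne) (Eventually.of_forall fun _ => zero_le) ?_
  filter_upwards [eventually_gt_atTop 0] with lam hlam
  exact (hN lam hlam).measure_weak_serving_le hp hlam.le (by linarith) ⟨ha.le, ha1⟩ hball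

/-- The coverage probability converges to that of a user served by the strongest possible link,
with an interfering Poisson process of density `rho`. -/
lemma tendsto_measure_coverage (hp : p.Valid) (hγ : 0 < γ) (hrho : 0 < rho)
    (hfin : p.totalAttenuation (γ / p.peak) ≠ ∞)
    (hN : ∀ lam, 0 < lam → (N lam).IsModel p (μ lam) lam rho) :
    Tendsto (fun lam => μ lam {ω | ENNReal.ofReal γ < (N lam).sinr p ω}) atTop
      (𝓝 (expNeg (ENNReal.ofReal (p.PN * γ / (p.P * p.peak)) +
        ENNReal.ofReal rho * p.totalAttenuation (γ / p.peak)))) := by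
  let κ := ENNReal.ofReal (p.PN * γ / (p.P * p.peak))
  let V := p.totalAttenuation (γ / p.peak)
  let cn : ℕ → ℝ := fun n => 1 + 1 / ((n : ℝ) + 1)
  have hcn : ∀ n, 1 < cn n := fun n => lt_add_of_pos_right _ (by positivity)
  have hcn1 : Tendsto cn atTop (𝓝 1) := by
    simpa [cn] using tendsto_one_div_add_atTop_nhds_zero_nat.const_add (1 : ℝ)
  have hdens : Tendsto (fun lam => ENNReal.ofReal (p.activeDensity lam rho)) atTop
      (𝓝 (ENNReal.ofReal rho)) :=
    (ENNReal.continuous_ofReal.tendsto _).comp (Params.tendsto_activeDensity hp rho)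
  have hX : Tendsto (fun lam => κ + ENNReal.ofReal (p.activeDensity lam rho) * V) atTop
      (𝓝 (κ + ENNReal.ofReal rho * V)) :=
    tendsto_const_nhds.add (ENNReal.Tendsto.mul_const hdens (Or.inr hfin))
  have hXfin : κ + ENNReal.ofReal rho * V ≠ ∞ :=
    ENNReal.add_ne_top.2 ⟨ENNReal.ofReal_ne_top, ENNReal.mul_ne_top ENNReal.ofReal_ne_top hfin⟩
  have hweak := fun n => tendsto_measure_weak_serving hp hN (hcn n)
  have hd : ∀ lam, 0 < lam → 0 ≤ p.activeDensity lam rho :=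
    fun lam hlam => Params.activeDensity_nonneg hp hlam hrho
  refine tendsto_order.2 ⟨fun a ha => ?_, fun b hb => ?_⟩
  -- The constant `cn n` is fixed close enough to one at the limiting density before `lam` is taken
  -- large; the upper bound uses the same order of limits.
  · have h1 : Tendsto (fun n => expNeg (ENNReal.ofReal (cn n) * (κ + ENNReal.ofReal rho * V)))
        atTop (𝓝 (expNeg (κ + ENNReal.ofReal rho * V))) := by
      have : Tendsto (fun n => ENNReal.ofReal (cn n) * (κ + ENNReal.ofReal rho * V)) atTop
          (𝓝 (ENNReal.ofReal 1 * (κ + ENNReal.ofReal rho * V))) :=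
        ENNReal.Tendsto.mul_const ((ENNReal.continuous_ofReal.tendsto _).comp hcn1) (Or.inr hXfin)
      rw [ENNReal.ofReal_one, one_mul] at this
      exact (continuous_expNeg.tendsto _).comp this
    obtain ⟨n, hn⟩ := (h1.eventually (lt_mem_nhds ha)).exists
    have h2 : Tendsto (fun lam => expNeg (ENNReal.ofReal (cn n) *
          (κ + ENNReal.ofReal (p.activeDensity lam rho) * V)) -
        μ lam {ω | ¬ p.peak ≤ cn n * (N lam).pathLoss p ((N lam).serving p ω) ω}) atTop
        (𝓝 (expNeg (ENNReal.ofReal (cn n) * (κ + ENNReal.ofReal rho * V)) - 0)) :=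
      ENNReal.Tendsto.sub ((continuous_expNeg.tendsto _).comp
        (ENNReal.Tendsto.const_mul hX (Or.inr ENNReal.ofReal_ne_top))) (hweak n)
        (Or.inr ENNReal.zero_ne_top)
    rw [tsub_zero] at h2
    filter_upwards [h2.eventually (lt_mem_nhds hn), eventually_gt_atTop 0] with lam hlt hlam
    exact hlt.trans_le (tsub_le_iff_right.2
      ((hN lam hlam).le_measure_coverage_add hp (hd lam hlam) hγ (hcn n).le))
  -- At the limiting density the remaining error is the chance of an active BS in the strong region,
  -- which vanishes with its area.
  · have h1 : Tendsto (fun n => expNeg (κ + ENNReal.ofReal rho * V) +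
          (0 + (1 - expNeg (ENNReal.ofReal rho * volume (p.strongRegion (cn n)))))) atTop
        (𝓝 (expNeg (κ + ENNReal.ofReal rho * V) +
          (0 + (1 - expNeg (ENNReal.ofReal rho * 0))))) := by
      refine tendsto_const_nhds.add (tendsto_const_nhds.add
        (ENNReal.Tendsto.sub tendsto_const_nhds ((continuous_expNeg.tendsto _).comp
          (ENNReal.Tendsto.const_mul (p.tendsto_volume_strongRegion hp)
            (Or.inr ENNReal.ofReal_ne_top))) (Or.inl ENNReal.one_ne_top)))
    rw [mul_zero, expNeg_zero, tsub_self, add_zero, add_zero] at h1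
    obtain ⟨n, hn⟩ := (h1.eventually (gt_mem_nhds hb)).exists
    have hbdd : volume (p.strongRegion (cn n)) ≠ ∞ :=
      (p.isBounded_strongRegion hp (by linarith [hcn n])).measure_lt_top.ne
    have h2 : Tendsto (fun lam =>
        expNeg (κ + ENNReal.ofReal (p.activeDensity lam rho) * V) +
        (μ lam {ω | ¬ p.peak ≤ cn n * (N lam).pathLoss p ((N lam).serving p ω) ω} +
        (1 - expNeg (ENNReal.ofReal (p.activeDensity lam rho) *
          volume (p.strongRegion (cn n)))))) atTop
        (𝓝 (expNeg (κ + ENNReal.ofReal rho * V) +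
          (0 + (1 - expNeg (ENNReal.ofReal rho * volume (p.strongRegion (cn n))))))) :=
      ((continuous_expNeg.tendsto _).comp hX).add ((hweak n).add
        (ENNReal.Tendsto.sub tendsto_const_nhds ((continuous_expNeg.tendsto _).comp
          (ENNReal.Tendsto.mul_const hdens (Or.inr hbdd))) (Or.inl ENNReal.one_ne_top)))
    filter_upwards [h2.eventually (gt_mem_nhds hn), eventually_gt_atTop 0] with lam hlt hlam
    exact ((hN lam hlam).measure_coverage_le hp (hd lam hlam) hγ (cn n)).trans_lt hlt

end Network

end SmallCell

end

/-! ### The main theorem -/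

theorem lemma2 (p : SmallCell.Params) (hp : p.Valid) (γ : ℝ) (hγ : 0 < γ)
    (hLoS : IntegrableOn (p.losIntegrand γ) (Ioi 0))
    (hNLoS : IntegrableOn (p.nlosIntegrand γ) (Ioi 0))
    (Ω : ℝ → ℝ → Type*) [∀ lam rho, MeasurableSpace (Ω lam rho)]
    (μ : ∀ lam rho, Measure (Ω lam rho)) [∀ lam rho, IsProbabilityMeasure (μ lam rho)]
    (N : ∀ lam rho, SmallCell.Network (Ω lam rho))
    (hN : ∀ lam rho, 0 < lam → 0 < rho → (N lam rho).IsModel p (μ lam rho) lam rho) :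
    (∀ rho, 0 < rho →
      Tendsto (fun lam => (N lam rho).pcov p (μ lam rho) γ) atTop (𝓝 (p.c γ * p.g γ ^ rho))) ∧
    StrictAntiOn (fun rho => limUnder atTop (fun lam => (N lam rho).pcov p (μ lam rho) γ))
      (Ioi 0) := by
  set I := (∫ u in Ioi (0 : ℝ), p.losIntegrand γ u) + ∫ u in Ioi (0 : ℝ), p.nlosIntegrand γ u
    with hI
  have hIpos : 0 < I := add_pos_of_pos_of_nonneg
    (SmallCell.Params.setIntegral_losIntegrand_pos hp hγ hLoS)
    (SmallCell.Params.setIntegral_nlosIntegrand_nonneg hp hγ)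
  have hV := SmallCell.Params.totalAttenuation_eq hp hγ hLoS hNLoS
  have hκ : 0 ≤ p.PN * γ / (p.P * p.peak) :=
    div_nonneg (mul_nonneg hp.PN_nonneg hγ.le) (mul_pos hp.P_pos (p.peak_pos hp)).le
  have hlim : ∀ rho, 0 < rho →
      Tendsto (fun lam => (N lam rho).pcov p (μ lam rho) γ) atTop
        (𝓝 (p.c γ * p.g γ ^ rho)) := fun rho hrho => by
    have h1 := SmallCell.Network.tendsto_measure_coverage (N := fun lam => N lam rho)
      (μ := fun lam => μ lam rho) hp hγ hrho (by rw [hV]; exact ENNReal.ofReal_ne_top)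
      (fun lam hlam => hN lam rho hlam hrho)
    have h2 := (ENNReal.tendsto_toReal (SmallCell.expNeg_ne_top _)).comp h1
    have hVpos : 0 ≤ rho * (2 * Real.pi * I) := by positivity
    rw [hV, ← hI, ← ENNReal.ofReal_mul hrho.le, ← ENNReal.ofReal_add hκ hVpos,
      SmallCell.expNeg_ofReal (add_nonneg hκ hVpos), ENNReal.toReal_ofReal (Real.exp_pos _).le,
      hI, ← SmallCell.Params.c_mul_g_rpow] at h2
    exact h2
  refine ⟨hlim, fun r₁ h₁ r₂ h₂ hlt => ?_⟩
  simp only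
  rw [(hlim r₁ h₁).limUnder_eq, (hlim r₂ h₂).limUnder_eq, SmallCell.Params.c_mul_g_rpow,
    SmallCell.Params.c_mul_g_rpow, ← hI, Real.exp_lt_exp]
  -- Strictness comes from `I > 0`: the exponent is affine in `rho` with slope `-2 π I`.
  have := mul_lt_mul_of_pos_right hlt (mul_pos (mul_pos two_pos Real.pi_pos) hIpos)
  linarith
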